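/- Let $1\le r\le m\le n$ be integers. For $s\in\{1,\dots,m\}$ let \[\mathcal M_s=\Big\{P\in(\mathbb C^*)^{m\times n}\ \Big|\ \sum_{i,j}p_{ij}=1,\ \operatorname{rk}P=s\Big\},\] and let $T_P\mathcal M_s$ denote its Zariski tangent space at $P$. For $U\in\mathbb N^{m\times n}$ let $\ell_U(Y)=\prod_{i,j}y_{ij}^{u_{ij}}$; a critical point of $\ell_U$ on $\mathcal M_s$ is a point $P\in\mathcal M_s$ such that the derivative of $\ell_U$ at $P$ vanishes in every direction $V\in T_P\mathcal M_s$. Equivalently, $\sum_{i,j}\frac{v_{ij}}{p_{ij}}u_{ij}=0$ for all $V\in T_P\mathcal M_s$; for arbitrary complex data $U\in\mathbb C^{m\times n}$ this last condition is taken as the definition of a critical point for $U$ on $\mathcal M_s$. Write $u_{i+}=\sum_j u_{ij}$, $u_{+j}=\sum_i u_{ij}$, $u_{++}=\sum_{i,j}u_{ij}$. "For sufficiently general $U$" means: for all $U$ at which some non-zero polynomial in the $mn$ entries (depending only on $m,n,r$) does not vanish. **Theorem (ML-duality for rectangular matrices).** 1. For sufficiently general $U$ in $\mathbb C^{m\times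 n}$ (in particular for sufficiently general $U\in\mathbb N^{m\times n}$ and the critical points of $\ell_U$), the following holds. For $P$ a critical point for $U$ on $\mathcal M_r$, define $Q=(q_{ij})$ by $q_{ij}p_{ij}=u_{i+}u_{ij}u_{+j}$ and put $Q'=Q/(u_{++})^3$. Then $Q'$ is a critical point for $U$ on $\mathcal M_{m-r+1}$, and the map $P\mapsto Q'$ is a bijection from the critical points on $\mathcal M_r$ onto the critical points on $\mathcal M_{m-r+1}$, whose inverse is given by the same formula. 2. There is a function $c$ on $\mathbb N^{m\times n}$, which does not depend on $r$, such that $\ell_U(P)\,\ell_U(Q')=c(U)$ for every sufficiently general $U\in\mathbb N^{m\times n}$ and every critical point $P$ of $\ell_U$ on $\mathcal M_r$. 3. The ML-degrees of $\mathcal M_r$ and $\mathcal M_{m-r+1}$ are well defined and equal: there is an integer $d>0$ such that for sufficiently general $U\in\mathbb C^{m\times n}$ there are exactly $d$ critical points for $U$ on $\mathcal M_r$, and exactly $d$ on $\mathcal M_{m-r+1}$. -/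

import Mathlib

open scoped BigOperators

namespace MLDuality

variable {m n : ℕ}

/-- The evaluation of a polynomial in the `m * n` coordinates at a matrix. -/
noncomputable def evalAt (f : MvPolynomial (Fin m × Fin n) ℂ) (Y : Matrix (Fin m) (Fin n) ℂ) : ℂ :=
  MvPolynomial.eval (fun ij => Y ij.1 ij.2) f

/-- The Zariski tangent space at `P` of a locally closed set `X` of matrices (with its reduced
structure): the vectors annihilated by the differentials at `P` of all polynomials that vanish
on `X`. -/
def tangentSpaceAt (X : Set (Matrix (Fin m) (Fin n) ℂ)) (P : Matrix (Fin m) (Fin n) ℂ) :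
    Set (Matrix (Fin m) (Fin n) ℂ) :=
  {V | ∀ f : MvPolynomial (Fin m × Fin n) ℂ, (∀ Y ∈ X, evalAt f Y = 0) →
    ∑ i, ∑ j, evalAt (MvPolynomial.pderiv (i, j) f) P * V i j = 0}

/-- The likelihood function `ℓ_U` of a data table `U` of natural numbers. -/
def likelihood (U : Matrix (Fin m) (Fin n) ℕ) (Y : Matrix (Fin m) (Fin n) ℂ) : ℂ :=
  ∏ i, ∏ j, Y i j ^ U i j

/-- The critical points of `ℓ_U` on `X`: the points `P` of `X` at which the derivative of `ℓ_U`
in every direction tangent to `X` vanishes. -/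
def criticalPoints (X : Set (Matrix (Fin m) (Fin n) ℂ)) (U : Matrix (Fin m) (Fin n) ℕ) :
    Set (Matrix (Fin m) (Fin n) ℂ) :=
  {P | P ∈ X ∧ ∀ V ∈ tangentSpaceAt X P, lineDeriv ℂ (likelihood U) P V = 0}

/-- The variety of critical points `Crit(X)` of a subvariety `X` of the torus: the pairs `(P, U)`
with `P` in `X`, and `U` a complex matrix orthogonal, in the standard symmetric bilinear form,
to all entrywise quotients `V / P` with `V` tangent to `X` at `P`. -/
def Crit (X : Set (Matrix (Fin m) (Fin n) ℂ)) :
    Set (Matrix (Fin m) (Fin n) ℂ × Matrix (Fin m) (Fin n) ℂ) :=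
  {PU | PU.1 ∈ X ∧ ∀ V ∈ tangentSpaceAt X PU.1, ∑ i, ∑ j, V i j / PU.1 i j * PU.2 i j = 0}

/-- The critical points on `X` for complex data `U`: the fibre of `Crit(X)` over `U`. -/
def critFiber (X : Set (Matrix (Fin m) (Fin n) ℂ)) (U : Matrix (Fin m) (Fin n) ℂ) :
    Set (Matrix (Fin m) (Fin n) ℂ) :=
  {P | (P, U) ∈ Crit X}

/-- The variety `M_r` of the `m × n` matrices of rank `r` with non-zero complex entries that
sum up to `1`. -/
def rankVariety (m n r : ℕ) : Set (Matrix (Fin m) (Fin n) ℂ) :=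
  {P | (∀ i j, P i j ≠ 0) ∧ ∑ i, ∑ j, P i j = 1 ∧ P.rank = r}

/-- `X` has ML-degree `d`: for all `U` outside some proper Zariski closed set of complex matrices
there are exactly `d` critical points on `X` for `U`, and `d` is positive (so that the projection
of `Crit(X)` to the space of data is dominant). -/
def HasMLDegree (X : Set (Matrix (Fin m) (Fin n) ℂ)) (d : ℕ) : Prop :=
  0 < d ∧ ∃ F : MvPolynomial (Fin m × Fin n) ℂ, F ≠ 0 ∧
    ∀ U : Matrix (Fin m) (Fin n) ℂ, evalAt F U ≠ 0 → (critFiber X U).encard = d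

/-- The matrix `Q' = Q / (u_{++})^3`, where `q_{ij} p_{ij} = u_{i+} u_{ij} u_{+j}`. -/
noncomputable def dual (U P : Matrix (Fin m) (Fin n) ℂ) : Matrix (Fin m) (Fin n) ℂ :=
  Matrix.of fun i j =>
    ((∑ j', U i j') * U i j * (∑ i', U i' j) / P i j) / (∑ i', ∑ j', U i' j') ^ 3

/-- The directional derivatives of the likelihood function on the torus. -/
theorem lineDeriv_likelihood (U : Matrix (Fin m) (Fin n) ℕ) (P V : Matrix (Fin m) (Fin n) ℂ)
    (hP : ∀ i j, P i j ≠ 0) :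
    lineDeriv ℂ (likelihood U) P V
      = likelihood U P * ∑ i, ∑ j, V i j / P i j * (U i j : ℂ) := by
  have key : ∀ i j, HasDerivAt (fun t : ℂ => (P i j + t * V i j) ^ U i j)
      (P i j ^ U i j * (V i j / P i j * (U i j : ℂ))) 0 := by
    intro i j
    have h := (((hasDerivAt_id (0 : ℂ)).mul_const (V i j)).const_add (P i j)).pow (U i j)
    refine h.congr_deriv ?_
    have := hP i j
    rcases hU : U i j with _ | k
    · simp
    · simp [pow_succ]
      field_simp
  have hprod : HasDerivAt
      (fun t : ℂ => ∏ x : Fin m × Fin n, (P x.1 x.2 + t * V x.1 x.2) ^ U x.1 x.2)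
      (∑ x : Fin m × Fin n, (∏ y ∈ Finset.univ.erase x,
        (P y.1 y.2 + 0 * V y.1 y.2) ^ U y.1 y.2) •
          (P x.1 x.2 ^ U x.1 x.2 * (V x.1 x.2 / P x.1 x.2 * (U x.1 x.2 : ℂ)))) 0 :=
    HasDerivAt.fun_finsetProd fun x _ => key x.1 x.2
  have hfun : (fun t : ℂ => likelihood U (P + t • V))
      = fun t : ℂ => ∏ x : Fin m × Fin n, (P x.1 x.2 + t * V x.1 x.2) ^ U x.1 x.2 := by
    funext t
    simp [likelihood, Fintype.prod_prod_type]
  rw [lineDeriv, hfun, hprod.deriv, ← Fintype.sum_prod_type'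
    (f := fun i j => V i j / P i j * (U i j : ℂ)), Finset.mul_sum]
  refine Finset.sum_congr rfl fun x _ => ?_
  have h1 : likelihood U P = ∏ x : Fin m × Fin n, P x.1 x.2 ^ U x.1 x.2 := by
    simp [likelihood, Fintype.prod_prod_type]
  rw [h1, ← Finset.prod_erase_mul _ _ (Finset.mem_univ x)]
  simp [mul_assoc]

/-- For integral data the two notions of critical points agree on subvarieties of the torus. -/
theorem criticalPoints_eq_critFiber (X : Set (Matrix (Fin m) (Fin n) ℂ))
    (hX : ∀ P ∈ X, ∀ i j, P i j ≠ 0) (U : Matrix (Fin m) (Fin n) ℕ) :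
    criticalPoints X U = critFiber X (U.map (fun u => (u : ℂ))) := by
  ext P
  refine and_congr_right fun hP => forall₂_congr fun V _ => ?_
  have h0 : likelihood U P ≠ 0 :=
    Finset.prod_ne_zero_iff.2 fun i _ => Finset.prod_ne_zero_iff.2 fun j _ =>
      pow_ne_zero _ (hX P hP i j)
  rw [lineDeriv_likelihood U P V (hX P hP)]
  simp [h0]

end MLDuality

/-! Write `R` for the residual `U / P - u_{++}` (entrywise quotient). A point `P` of rank `r` and
total one is critical exactly when `R * Pᵀ = 0` and `Pᵀ * R = 0` (`mem_critFiber_rankVariety_iff`):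
`R` lies in the conormal space of the rank variety at `P`. The condition is symmetric enough to be
dualized. Adding `u_{++}` to every entry of `R` raises its rank by exactly one, so `U / P` has rank
`rank R + 1` (`rank_quotient`). Scaling its rows and columns by the margins of `U` preserves the
rank, and the critical equations of `P` turn into those of `Q'` (`dual_mem_critFiber`). The formula
for `Q'` is visibly an involution, and in the product of the two likelihoods the entries of `P`
cancel.

It remains that `R` has rank `m - r` for general `U`. Where the upper left block `M` is invertible,
`P` is given by `(M, X, Y)` and `R` by a free block `N` (`lowRank`, `conormal`). Thus, up to
scaling, the pairs `(P, U)` are parametrized by an affine space of dimension `mn`, with `U = P (R +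
1)` entrywise (`dataMap`). A proper hypersurface in this space, such as a rank drop of `N`, is
avoided over general `U` simply by dimension (`exists_generic_ne_zero`).

For the ML-degree, the data map is also dominant: at a suitable positive real point its differential
is injective (`algebraicIndependent_chartMap`). A dominant polynomial map between affine spaces of
equal dimension has a constant positive number of points in its general fibres
(`exists_generic_encard_fiber`), and the duality bijection makes the two degrees equal. -/

namespace MLDuality

set_option linter.unusedSectionVars false

/-! ### Primitive elements with controlled denominators. -/

open Polynomial in
/-- A generically finite extension of domains of characteristic zero is, up to denominators,
generated by one element, whose minimal polynomial is separable. -/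
theorem exists_generic_primitive {S A ι : Type*} [CommRing S] [IsDomain S] [CharZero S]
    [CommRing A] [IsDomain A] [Algebra S A] [FaithfulSMul S A] [Algebra.IsAlgebraic S A]
    [Algebra.FiniteType S A] [Finite ι] (x : ι → A) :
    ∃ (θ : A) (f a b : S[X]) (g : ι → S[X]) (s c : S), s ≠ 0 ∧ c ≠ 0 ∧ 0 < f.natDegree ∧
      aeval θ f = 0 ∧ a * f + b * derivative f = C c ∧
      (∀ i, s • x i = aeval θ (g i)) ∧
      ∀ G : S[X], aeval θ G = 0 → ∃ e ≠ (0 : S), ∃ q, C e * G = f * q := by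
  let L := FractionRing S
  let K := FractionRing A
  let : Algebra L K := FractionRing.liftAlgebra S K
  have : IsScalarTower S L K := FractionRing.isScalarTower_liftAlgebra S K
  have : Algebra.IsAlgebraic S K := by
    have : Algebra.IsAlgebraic A K :=
      (IsFractionRing.comap_isAlgebraic_iff (K := K)).mpr inferInstance
    exact Algebra.IsAlgebraic.trans S A K
  have : Algebra.IsAlgebraic L K :=
    (IsFractionRing.comap_isAlgebraic_iff (A := S)).mp inferInstance
  have : Algebra.EssFiniteType A K := Algebra.EssFiniteType.of_isLocalization K (nonZeroDivisors A)
  have : Algebra.EssFiniteType S K := .comp S A K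
  have : Algebra.EssFiniteType L K := .of_comp S L K
  have : FiniteDimensional L K :=
    Algebra.finite_of_essFiniteType_of_isAlgebraic
  have : CharZero L := IsFractionRing.charZero S
  obtain ⟨α, hα⟩ := Field.exists_primitive_element L K
  -- A primitive element `p / q` can be moved into `A`: algebraicity makes its denominator a divisor
  -- of a scalar, so it equals `θ / d` with `d` in `S`, and `θ` generates the same field.
  obtain ⟨θ, hθ⟩ : ∃ θ : A, IntermediateField.adjoin L {algebraMap A K θ} = ⊤ := by
    obtain ⟨p, q, hq, rfl⟩ := IsFractionRing.div_surjective (A := A) α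
    obtain ⟨θ, d, hd, h⟩ := Algebra.IsAlgebraic.exists_smul_eq_mul S p (nonZeroDivisors.ne_zero hq)
    refine ⟨θ, ?_⟩
    rw [eq_top_iff, ← hα, IntermediateField.adjoin_simple_le_iff]
    have hq0 : algebraMap A K q ≠ 0 := by simpa using nonZeroDivisors.ne_zero hq
    have hd0 : algebraMap L K (algebraMap S L d) ≠ 0 := by simpa using hd
    have : algebraMap A K p / algebraMap A K q =
        (algebraMap L K (algebraMap S L d))⁻¹ * algebraMap A K θ := by
      rw [← IsScalarTower.algebraMap_apply, IsScalarTower.algebraMap_apply S A K]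
      rw [← IsScalarTower.algebraMap_apply, IsScalarTower.algebraMap_apply S A K] at hd0
      have := congrArg (algebraMap A K) h
      rw [Algebra.smul_def, map_mul, map_mul] at this
      rw [inv_mul_eq_div, div_eq_div_iff hq0 hd0]
      linear_combination this
    rw [this]
    exact mul_mem (inv_mem (IntermediateField.algebraMap_mem _ _))
      (IntermediateField.mem_adjoin_simple_self _ _)
  set θ' := algebraMap A K θ with hθ'
  have hint : IsIntegral L θ' := Algebra.IsIntegral.isIntegral θ'
  have hinj : Function.Injective (algebraMap S L) := IsFractionRing.injective S L
  have hinjK : Function.Injective (algebraMap A K) := IsFractionRing.injective A K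
  have hinjm : Function.Injective (Polynomial.map (algebraMap S L)) := map_injective _ hinj
  have haev : ∀ G : S[X], aeval θ' (G.map (algebraMap S L)) = algebraMap A K (aeval θ G) := by
    intro G
    rw [aeval_map_algebraMap, hθ', aeval_algebraMap_apply]
  -- The field identities over `L` are brought back to `S` one by one with this clearing of
  -- denominators; the scalars collected here become `s`, `c` and `e`.
  have clear : ∀ p : L[X], ∃ (q : S[X]) (e : S), e ≠ 0 ∧
      q.map (algebraMap S L) = C (algebraMap S L e) * p := by
    intro p
    obtain ⟨e, he, h⟩ := IsLocalization.integerNormalization_spec (nonZeroDivisors S) p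
    refine ⟨_, e, nonZeroDivisors.ne_zero he, h.trans ?_⟩
    rw [← algebraMap_smul L e p, smul_eq_C_mul]
  obtain ⟨f, e, he, hf⟩ := clear (minpoly L θ')
  have heL : algebraMap S L e ≠ 0 := by simpa using he
  have hdeg : f.natDegree = (minpoly L θ').natDegree := by
    rw [← natDegree_map_eq_of_injective hinj, hf, natDegree_C_mul heL]
  have hsep : (minpoly L θ').Separable := Algebra.IsSeparable.isSeparable L θ'
  obtain ⟨a₀, b₀, hab⟩ := (separable_def' _).1 hsep
  obtain ⟨a, ea, hea, ha⟩ := clear a₀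
  obtain ⟨b, eb, heb, hb⟩ := clear b₀
  have hx : ∀ i, ∃ (g : S[X]) (s : S), s ≠ 0 ∧ s • x i = aeval θ g := by
    intro i
    have hadj : algebraMap A K (x i) ∈ (IntermediateField.adjoin L {θ'}).toSubalgebra := by
      rw [hθ]; trivial
    rw [IntermediateField.adjoin_simple_toSubalgebra_of_isAlgebraic hint.isAlgebraic,
      Algebra.adjoin_singleton_eq_range_aeval] at hadj
    obtain ⟨p, hp⟩ := hadj
    obtain ⟨g, s, hs, hg⟩ := clear p
    refine ⟨g, s, hs, hinjK ?_⟩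
    rw [← haev, hg, map_mul, aeval_C, Algebra.smul_def, map_mul,
      ← IsScalarTower.algebraMap_apply, ← IsScalarTower.algebraMap_apply]
    exact congrArg _ hp.symm
  choose g s hs hg using hx
  cases nonempty_fintype ι
  classical
  refine ⟨θ, f, C eb * a, C ea * b, fun i => C (∏ j ∈ Finset.univ.erase i, s j) * g i, ∏ i, s i,
    ea * eb * e, Finset.prod_ne_zero_iff.2 fun i _ => hs i, mul_ne_zero (mul_ne_zero hea heb) he,
    ?_, ?_, ?_, ?_, ?_⟩
  · rw [hdeg]; exact minpoly.natDegree_pos hint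
  · apply hinjK
    rw [← haev, hf, map_mul, minpoly.aeval, mul_zero, map_zero]
  · apply hinjm
    simp only [Polynomial.map_add, Polynomial.map_mul, map_C, ha, hb, hf, ← derivative_map,
      derivative_C_mul, map_mul]
    linear_combination (C (algebraMap S L ea) * C (algebraMap S L eb) * C (algebraMap S L e)) * hab
  · intro i
    rw [map_mul, aeval_C, ← hg, ← Finset.prod_erase_mul _ _ (Finset.mem_univ i), mul_smul,
      Algebra.smul_def]
  · intro G hG
    have : minpoly L θ' ∣ G.map (algebraMap S L) := by
      apply minpoly.dvd
      rw [haev, hG, map_zero]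
    obtain ⟨q₀, hq₀⟩ := this
    obtain ⟨q, eq, heq, hq⟩ := clear q₀
    refine ⟨e * eq, mul_ne_zero he heq, q, hinjm ?_⟩
    simp only [Polynomial.map_mul, map_C, hf, hq, map_mul, hq₀]
    ring

/-! ### General fibres of polynomial maps between affine spaces. -/

section Generic

variable {ι κ : Type*}

open MvPolynomial in
/-- As many algebraically independent polynomials as there are variables form a transcendence
basis. -/
theorem isTranscendenceBasis_of_card_le [Fintype ι] [Fintype κ] {φ : κ → MvPolynomial ι ℂ}
    (hcard : Fintype.card ι ≤ Fintype.card κ) (hφ : AlgebraicIndependent ℂ φ) :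
    IsTranscendenceBasis ℂ φ := by
  refine hφ.isTranscendenceBasis_of_lift_trdeg_le_of_finite ?_
  rw [MvPolynomial.trdeg_of_isDomain]
  simpa using hcard

-- The target ring is algebraic over the subalgebra generated by a transcendence basis; the
-- coefficients are transported back along the isomorphism of that subalgebra with the polynomial
-- ring.
open MvPolynomial in
theorem isAlgebraic_of_algebraicIndependent [Fintype ι] [Fintype κ] {φ : κ → MvPolynomial ι ℂ}
    (hcard : Fintype.card ι ≤ Fintype.card κ) (hφ : AlgebraicIndependent ℂ φ) :
    letI := (aeval φ : MvPolynomial κ ℂ →ₐ[ℂ] MvPolynomial ι ℂ).toRingHom.toAlgebra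
    Algebra.IsAlgebraic (MvPolynomial κ ℂ) (MvPolynomial ι ℂ) := by
  let := (aeval φ : MvPolynomial κ ℂ →ₐ[ℂ] MvPolynomial ι ℂ).toRingHom.toAlgebra
  have h := (isTranscendenceBasis_of_card_le hcard hφ).isAlgebraic
  refine ⟨fun p => ?_⟩
  obtain ⟨g, hg, hp⟩ := h.isAlgebraic p
  let e := hφ.aevalEquiv
  refine ⟨g.map (e.symm : _ →+* MvPolynomial κ ℂ), ?_, ?_⟩
  · rwa [Ne, Polynomial.map_eq_zero_iff]
    exact e.symm.injective
  · rw [Polynomial.aeval_def, Polynomial.eval₂_map]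
    rw [Polynomial.aeval_def] at hp
    convert hp using 2
    ext1 a
    obtain ⟨b, rfl⟩ := e.surjective a
    change aeval φ (e.symm (e b)) = (e b : MvPolynomial ι ℂ)
    rw [AlgEquiv.symm_apply_apply]
    exact (hφ.algebraMap_aevalEquiv b).symm

open MvPolynomial in
/-- The evaluation of a composition. -/
theorem eval_aeval_family (φ : κ → MvPolynomial ι ℂ) (x : ι → ℂ) (F : MvPolynomial κ ℂ) :
    eval x (aeval φ F) = eval (fun k => eval x (φ k)) F := by
  rw [← coe_aeval_eq_eval, ← coe_aeval_eq_eval, RingHom.coe_coe, RingHom.coe_coe,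
    ← AlgHom.comp_apply, comp_aeval]

open MvPolynomial in
/-- Over a general point, a polynomial map to a space of at least the same dimension meets no
given proper hypersurface. -/
theorem exists_generic_ne_zero [Fintype ι] [Fintype κ] (hcard : Fintype.card ι ≤ Fintype.card κ)
    (φ : κ → MvPolynomial ι ℂ) {h : MvPolynomial ι ℂ} (hh : h ≠ 0) :
    ∃ F : MvPolynomial κ ℂ, F ≠ 0 ∧
      ∀ x : ι → ℂ, eval (fun k => eval x (φ k)) F ≠ 0 → eval x h ≠ 0 := by
  by_cases hφ : AlgebraicIndependent ℂ φ
  · let := (aeval φ : MvPolynomial κ ℂ →ₐ[ℂ] MvPolynomial ι ℂ).toRingHom.toAlgebra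
    have := isAlgebraic_of_algebraicIndependent hcard hφ
    -- Algebraicity gives a non-zero multiple of `h` that is pulled back from the target.
    obtain ⟨r, hr, q, hq⟩ :=
      (Algebra.IsAlgebraic.isAlgebraic (R := MvPolynomial κ ℂ) h).exists_nonzero_dvd
      (mem_nonZeroDivisors_of_ne_zero hh)
    refine ⟨r, hr, fun x hx h0 => hx ?_⟩
    rw [← eval_aeval_family]
    have : aeval φ r = h * q := hq
    rw [this, map_mul, h0, zero_mul]
  -- Without dominance, an algebraic relation among the `φ k` serves as `F`: it vanishes on the
  -- whole image.
  · rw [AlgebraicIndependent, injective_iff_map_eq_zero] at hφ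
    push Not at hφ
    obtain ⟨F, hF, hF0⟩ := hφ
    refine ⟨F, hF0, fun x hx => absurd ?_ hx⟩
    rw [← eval_aeval_family, hF, map_zero]

open Polynomial in
/-- Substituting `g / s` into a polynomial and clearing denominators. -/
theorem exists_homogenized {S A : Type*} [CommRing S] [CommRing A] [Algebra S A] [Algebra ℂ S]
    [Algebra ℂ A] [IsScalarTower ℂ S A] (x : ι → A) (θ : A) (g : ι → S[X]) (s : S)
    (hg : ∀ i, s • x i = aeval θ (g i)) (p : MvPolynomial ι ℂ) :
    ∃ (D : ℕ) (G : S[X]), s ^ D • MvPolynomial.aeval x p = aeval θ G ∧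
      ∀ (ev : S →ₐ[ℂ] ℂ) (t : ℂ), ev s ≠ 0 →
        G.eval₂ (ev : S →+* ℂ) t
          = ev s ^ D * MvPolynomial.eval (fun i => (g i).eval₂ (ev : S →+* ℂ) t / ev s) p := by
  induction p using MvPolynomial.induction_on with
  | C a =>
    refine ⟨0, C (algebraMap ℂ S a), ?_, fun ev t _ => ?_⟩
    · simp [← IsScalarTower.algebraMap_apply]
    · simp
  | add p q hp hq =>
    obtain ⟨D, G, h1, h2⟩ := hp
    obtain ⟨E, H, h3, h4⟩ := hq
    refine ⟨D + E, C (s ^ E) * G + C (s ^ D) * H, ?_, fun ev t hs => ?_⟩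
    · simp only [map_add, map_mul, aeval_C, ← h1, ← h3, pow_add, Algebra.smul_def]
      ring
    · simp only [eval₂_add, eval₂_mul, eval₂_C, h2 ev t hs, h4 ev t hs, map_add]
      simp only [RingHom.coe_coe, map_pow]
      ring
  | mul_X p i hp =>
    obtain ⟨D, G, h1, h2⟩ := hp
    refine ⟨D + 1, G * g i, ?_, fun ev t hs => ?_⟩
    · simp only [map_mul, MvPolynomial.aeval_X, ← h1, ← hg, pow_succ, Algebra.smul_def]
      ring
    · simp only [eval₂_mul, h2 ev t hs, map_mul, MvPolynomial.eval_X]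
      field_simp
      ring

open MvPolynomial in
/-- A dominant polynomial map between affine spaces of the same dimension has a constant positive
number of points in its general fibres. -/
theorem exists_generic_encard_fiber [Fintype ι] [Fintype κ]
    (hcard : Fintype.card ι ≤ Fintype.card κ)
    {φ : κ → MvPolynomial ι ℂ} (hφ : AlgebraicIndependent ℂ φ) :
    ∃ d : ℕ, 0 < d ∧ ∃ F : MvPolynomial κ ℂ, F ≠ 0 ∧ ∀ u : κ → ℂ, eval u F ≠ 0 →
      {x : ι → ℂ | ∀ k, eval x (φ k) = u k}.encard = d := by
  let Φ : MvPolynomial κ ℂ →ₐ[ℂ] MvPolynomial ι ℂ := aeval φ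
  let := Φ.toRingHom.toAlgebra
  have hmap : ∀ p : MvPolynomial κ ℂ,
      algebraMap (MvPolynomial κ ℂ) (MvPolynomial ι ℂ) p = aeval φ p := fun _ => rfl
  have : IsScalarTower ℂ (MvPolynomial κ ℂ) (MvPolynomial ι ℂ) :=
    IsScalarTower.of_algebraMap_eq fun z => (Φ.commutes z).symm
  have := isAlgebraic_of_algebraicIndependent hcard hφ
  have : FaithfulSMul (MvPolynomial κ ℂ) (MvPolynomial ι ℂ) :=
    (faithfulSMul_iff_algebraMap_injective _ _).2 hφ
  have : Algebra.FiniteType (MvPolynomial κ ℂ) (MvPolynomial ι ℂ) :=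
    Algebra.FiniteType.of_restrictScalars_finiteType ℂ _ _
  obtain ⟨θ, f, a, b, g, s, c, hs, hc, hdeg, hfθ, hab, hg, hdvd⟩ :=
    exists_generic_primitive (S := MvPolynomial κ ℂ) (X : ι → MvPolynomial ι ℂ)
  -- the relations which have to specialize
  have hrel : ∀ (p : MvPolynomial ι ℂ) (h : Polynomial (MvPolynomial κ ℂ)),
      Polynomial.aeval θ h = p → ∃ e ≠ (0 : MvPolynomial κ ℂ), ∀ (u : κ → ℂ) (t : ℂ),
        eval u e ≠ 0 → eval u s ≠ 0 → f.eval₂ (eval u) t = 0 →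
          eval (fun i => (g i).eval₂ (eval u) t / eval u s) p = h.eval₂ (eval u) t := by
    intro p h hp
    obtain ⟨D, G, h1, h2⟩ := exists_homogenized X θ g s hg p
    -- A relation that holds at `θ` is divisible by `f` up to a scalar `e`, so it persists at every
    -- root of the specialized `f` where `e` does not vanish.
    obtain ⟨e, he, q, hq⟩ := hdvd (G - Polynomial.C (s ^ D) * h) (by
      rw [map_sub, map_mul, ← h1, hp, Polynomial.aeval_C, aeval_X_left_apply, Algebra.smul_def,
        sub_self])
    refine ⟨e, he, fun u t heu hsu hft => ?_⟩
    have h3 := congrArg (Polynomial.eval₂ (eval u) t) hq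
    rw [Polynomial.eval₂_mul, Polynomial.eval₂_mul, hft, zero_mul, Polynomial.eval₂_C,
      mul_eq_zero, or_iff_right heu, Polynomial.eval₂_sub, Polynomial.eval₂_mul,
      Polynomial.eval₂_C, sub_eq_zero] at h3
    have h4 := h2 (aeval u) t (by simpa using hsu)
    have hco : ((aeval u : MvPolynomial κ ℂ →ₐ[ℂ] ℂ) : MvPolynomial κ ℂ →+* ℂ) = eval u :=
      coe_aeval_eq_eval u
    rw [hco, h3, map_pow] at h4
    exact (mul_left_cancel₀ (pow_ne_zero D hsu) h4).symm
  choose e he hrel' using fun k => hrel (φ k) (Polynomial.C (X k)) (by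
    rw [Polynomial.aeval_C, hmap, aeval_X])
  obtain ⟨e', he', hrelθ⟩ := hrel θ Polynomial.X (by rw [Polynomial.aeval_X])
  have hlead : f.leadingCoeff ≠ 0 := by
    rw [Polynomial.leadingCoeff_ne_zero]; rintro rfl; simp at hdeg
  -- The factors guarantee, in order: `g / s` is defined, `f` stays separable, the relations for `φ
  -- k` and for `θ` specialize, and the degree of `f` does not drop.
  refine ⟨f.natDegree, hdeg, s * c * (∏ k, e k) * e' * f.leadingCoeff, ?_, fun u hu => ?_⟩
  · exact mul_ne_zero (mul_ne_zero (mul_ne_zero (mul_ne_zero hs hc)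
      (Finset.prod_ne_zero_iff.2 fun k _ => he k)) he') hlead
  simp only [map_mul, map_prod, mul_ne_zero_iff, Finset.prod_ne_zero_iff] at hu
  obtain ⟨⟨⟨⟨hsu, hcu⟩, heu⟩, heu'⟩, hlu⟩ := hu
  set fu : Polynomial ℂ := f.map (eval u) with hfu
  have hfu_deg : fu.natDegree = f.natDegree :=
    Polynomial.natDegree_map_of_leadingCoeff_ne_zero _ hlu
  have hfu0 : fu ≠ 0 := by
    intro h; rw [h] at hfu_deg; simp at hfu_deg; omega
  have hsep : fu.Separable := by
    rw [Polynomial.separable_def']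
    have := congrArg (Polynomial.map (eval u)) hab
    simp only [Polynomial.map_add, Polynomial.map_mul, Polynomial.map_C,
      ← Polynomial.derivative_map] at this
    refine ⟨Polynomial.C (eval u c)⁻¹ * a.map (eval u),
      Polynomial.C (eval u c)⁻¹ * b.map (eval u), ?_⟩
    rw [mul_assoc, mul_assoc, ← mul_add, this, ← Polynomial.C_mul, inv_mul_cancel₀ hcu,
      Polynomial.C_1]
  have hcardroots : (fu.rootSet ℂ).encard = f.natDegree := by
    rw [← hfu_deg, ← Polynomial.card_rootSet_eq_natDegree hsep (IsAlgClosed.splits (k := ℂ) _),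
      Set.encard_eq_coe_toFinset_card, Set.toFinset_card]
  have hroot : ∀ t, t ∈ fu.rootSet ℂ ↔ f.eval₂ (eval u) t = 0 := by
    intro t
    rw [Polynomial.mem_rootSet_of_ne hfu0, Polynomial.coe_aeval_eq_eval, hfu, Polynomial.eval_map]
  have hspec : ∀ (x : ι → ℂ), (∀ k, eval x (φ k) = u k) → ∀ h : Polynomial (MvPolynomial κ ℂ),
      eval x (Polynomial.aeval θ h) = h.eval₂ (eval u) (eval x θ) := by
    intro x hx h
    rw [Polynomial.aeval_def, Polynomial.hom_eval₂]
    congr 1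
    refine RingHom.ext fun p => ?_
    rw [RingHom.comp_apply, hmap, eval_aeval_family]
    simp_rw [hx]
  rw [← hcardroots]
  -- The fibre corresponds to the roots of the specialized `f` by `x ↦ θ(x)`, with inverse `t ↦ g(t)
  -- / s`.
  refine Set.encard_congr ⟨fun x => ⟨eval x.1 θ, ?_⟩,
    fun t => ⟨fun i => (g i).eval₂ (eval u) t.1 / eval u s, ?_⟩, fun x => ?_, fun t => ?_⟩
  · rw [hroot, ← hspec x.1 x.2, hfθ, map_zero]
  · intro k
    rw [hrel' k u t.1 (heu k (Finset.mem_univ k)) hsu ((hroot _).1 t.2), Polynomial.eval₂_C, eval_X]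
  · apply Subtype.ext
    funext i
    have := congrArg (eval x.1) (hg i)
    rw [hspec x.1 x.2, Algebra.smul_def, map_mul, eval_X, hmap, eval_aeval_family] at this
    simp_rw [x.2 _] at this
    change Polynomial.eval₂ (eval u) (eval x.1 θ) (g i) / eval u s = x.1 i
    rw [← this]
    field_simp
  · apply Subtype.ext
    change eval (fun i => (g i).eval₂ (eval u) t.1 / eval u s) θ = t.1
    rw [hrelθ u t.1 heu' hsu ((hroot _).1 t.2), Polynomial.eval₂_X]

end Generic

/-! ### Matrices of bounded rank and their conormal matrices in block form. -/

section Blocks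

open Matrix

variable {S R A B : Type*} [CommRing S] [Fintype R] [Fintype A] [Fintype B]
  [DecidableEq R] [DecidableEq A] [DecidableEq B]

/-- The parametrization of the matrices of rank at most `card R`, in the chart in which the upper
left block is invertible. -/
def lowRank (M : Matrix R R S) (X : Matrix A R S) (Y : Matrix R B S) : Matrix (R ⊕ A) (R ⊕ B) S :=
  fromRows 1 X * M * fromCols 1 Y

/-- The parametrization of the conormal space to the matrices of bounded rank. -/
def conormal (N : Matrix A B S) (X : Matrix A R S) (Y : Matrix R B S) :
    Matrix (R ⊕ A) (R ⊕ B) S :=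
  (fromCols (-X) 1)ᵀ * N * (fromRows (-Y) 1)ᵀ

theorem lowRank_eq_fromBlocks (M : Matrix R R S) (X : Matrix A R S) (Y : Matrix R B S) :
    lowRank M X Y = fromBlocks M (M * Y) (X * M) (X * M * Y) := by
  simp [lowRank, fromRows_mul, mul_fromCols]

theorem conormal_eq_fromBlocks (N : Matrix A B S) (X : Matrix A R S) (Y : Matrix R B S) :
    conormal N X Y = fromBlocks (Xᵀ * N * Yᵀ) (-(Xᵀ * N)) (-(N * Yᵀ)) N := by
  simp [conormal, transpose_fromCols, transpose_fromRows, fromRows_mul, mul_fromCols]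

theorem conormal_mul_lowRank_transpose (M : Matrix R R S) (N : Matrix A B S) (X : Matrix A R S)
    (Y : Matrix R B S) : conormal N X Y * (lowRank M X Y)ᵀ = 0 := by
  have : fromCols (1 : Matrix R R S) Y * fromRows (-Y) (1 : Matrix B B S) = 0 := by
    simp [fromCols_mul_fromRows]
  have h : (fromRows (-Y) (1 : Matrix B B S))ᵀ * (fromCols (1 : Matrix R R S) Y)ᵀ = 0 := by
    rw [← transpose_mul, this, transpose_zero]
  rw [conormal, lowRank, transpose_mul, Matrix.mul_assoc, ← Matrix.mul_assoc (fromRows _ _)ᵀ, h,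
    Matrix.zero_mul, Matrix.mul_zero]

theorem lowRank_transpose_mul_conormal (M : Matrix R R S) (N : Matrix A B S) (X : Matrix A R S)
    (Y : Matrix R B S) : (lowRank M X Y)ᵀ * conormal N X Y = 0 := by
  have : fromCols (-X) (1 : Matrix A A S) * fromRows (1 : Matrix R R S) X = 0 := by
    simp [fromCols_mul_fromRows]
  have h : (fromRows (1 : Matrix R R S) X)ᵀ * (fromCols (-X) (1 : Matrix A A S))ᵀ = 0 := by
    rw [← transpose_mul, this, transpose_zero]
  rw [conormal, lowRank, transpose_mul, transpose_mul, Matrix.mul_assoc, Matrix.mul_assoc,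
    Matrix.mul_assoc, ← Matrix.mul_assoc (fromRows _ _)ᵀ, h, Matrix.zero_mul, Matrix.mul_zero,
    Matrix.mul_zero]

/-- Since `M` is invertible, the block equations that contain it can be solved for the other three
blocks of `W` in terms of the lower right one. So the conormal space in the chart is freely
parametrized by `N`. -/
theorem eq_conormal {M : Matrix R R S} (hM : IsUnit M) {X : Matrix A R S} {Y : Matrix R B S}
    {W : Matrix (R ⊕ A) (R ⊕ B) S} (h1 : W * (lowRank M X Y)ᵀ = 0)
    (h2 : (lowRank M X Y)ᵀ * W = 0) : W = conormal W.toBlocks₂₂ X Y := by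
  obtain ⟨M', hM1, hM2⟩ := isUnit_iff_exists.1 ((isUnit_transpose M).2 hM)
  have cancel₁ : ∀ {T : Matrix A R S}, T * Mᵀ = 0 → T = 0 := fun {T} h => by
    rw [← Matrix.mul_one T, ← hM1, ← Matrix.mul_assoc, h, Matrix.zero_mul]
  have cancel₂ : ∀ {T : Matrix R R S}, T * Mᵀ = 0 → T = 0 := fun {T} h => by
    rw [← Matrix.mul_one T, ← hM1, ← Matrix.mul_assoc, h, Matrix.zero_mul]
  have cancel₃ : ∀ {T : Matrix R B S}, Mᵀ * T = 0 → T = 0 := fun {T} h => by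
    rw [← Matrix.one_mul T, ← hM2, Matrix.mul_assoc, h, Matrix.mul_zero]
  rw [lowRank_eq_fromBlocks, ← fromBlocks_toBlocks W, fromBlocks_transpose, fromBlocks_multiply,
    ← fromBlocks_zero, fromBlocks_inj] at h1 h2
  obtain ⟨h11, -, h13, -⟩ := h1
  obtain ⟨h21, h22, -, -⟩ := h2
  rw [transpose_mul, ← Matrix.mul_assoc, ← Matrix.add_mul] at h11 h13
  rw [transpose_mul, Matrix.mul_assoc, ← Matrix.mul_add] at h22
  conv_lhs => rw [← fromBlocks_toBlocks W]
  rw [conormal_eq_fromBlocks, fromBlocks_inj]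
  have h12 := eq_neg_of_add_eq_zero_left (cancel₃ h22)
  refine ⟨?_, h12, eq_neg_of_add_eq_zero_left (cancel₁ h13), rfl⟩
  rw [eq_neg_of_add_eq_zero_left (cancel₂ h11), h12, Matrix.neg_mul, neg_neg]

/-- The pairing of a matrix with a conormal matrix. -/
theorem sum_mul_conormal (V : Matrix (R ⊕ A) (R ⊕ B) S) (N : Matrix A B S) (X : Matrix A R S)
    (Y : Matrix R B S)
    (hV : fromCols (-X) (1 : Matrix A A S) * V * fromRows (-Y) (1 : Matrix B B S) = 0) :
    ∑ i, ∑ j, V i j * conormal N X Y i j = 0 := by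
  have := sum_hadamard_eq (A := V) (B := conormal N X Y)
  simp only [hadamard_apply] at this
  rw [this, conormal, transpose_mul, transpose_mul, transpose_transpose, transpose_transpose,
    ← Matrix.mul_assoc, ← Matrix.mul_assoc, Matrix.trace_mul_comm, ← Matrix.mul_assoc,
     ← Matrix.mul_assoc, hV, Matrix.zero_mul, Matrix.trace_zero]

end Blocks

/-! ### Every matrix of rank `r` lies in a chart. -/

section RankCharts

open Matrix

variable {F R A B : Type*} [Field F] [Fintype R] [Fintype A] [Fintype B]
  [DecidableEq R] [DecidableEq A] [DecidableEq B]

theorem rank_lowRank {M : Matrix R R F} (hM : IsUnit M) (X : Matrix A R F) (Y : Matrix R B F) :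
    (lowRank M X Y).rank = Fintype.card R := by
  apply le_antisymm
  · rw [lowRank, Matrix.mul_assoc]
    exact (rank_mul_le_left _ _).trans (rank_le_card_width _)
  · rw [← rank_of_isUnit M hM]
    have : M = fromCols (1 : Matrix R R F) (0 : Matrix R A F) * lowRank M X Y *
        fromRows (1 : Matrix R R F) (0 : Matrix B R F) := by
      rw [lowRank, ← Matrix.mul_assoc, ← Matrix.mul_assoc, fromCols_mul_fromRows, Matrix.mul_assoc,
        fromCols_mul_fromRows]
      simp
    conv_lhs => rw [this]
    exact (rank_mul_le_left _ _).trans (rank_mul_le_right _ _)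

/-- A matrix whose rank is at most the size of its invertible upper left block is determined
by the blocks other than the lower right one. -/
theorem eq_lowRank {Z : Matrix (R ⊕ A) (R ⊕ B) F} (hM : IsUnit Z.toBlocks₁₁)
    (hZ : Z.rank ≤ Fintype.card R) :
    Z = lowRank Z.toBlocks₁₁ (Z.toBlocks₂₁ * Z.toBlocks₁₁⁻¹) (Z.toBlocks₁₁⁻¹ * Z.toBlocks₁₂) := by
  have hdet : IsUnit Z.toBlocks₁₁.det := (isUnit_iff_isUnit_det _).1 hM
  set C : Matrix (R ⊕ A) R F := fromRows Z.toBlocks₁₁ Z.toBlocks₂₁ with hC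
  have hCZ : C = Z * fromRows (1 : Matrix R R F) (0 : Matrix B R F) := by
    conv_rhs => rw [← fromBlocks_toBlocks Z, fromBlocks_mul_fromRows]
    simp [hC]
  have hle : LinearMap.range C.mulVecLin ≤ LinearMap.range Z.mulVecLin := by
    rw [hCZ, mulVecLin_mul]; exact LinearMap.range_comp_le_range _ _
  have hrank : Z.rank ≤ C.rank := by
    refine hZ.trans ?_
    rw [← rank_of_isUnit _ hM]
    have : Z.toBlocks₁₁ = fromCols (1 : Matrix R R F) (0 : Matrix R A F) * C := by
      rw [hC, fromCols_mul_fromRows]; simp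
    conv_lhs => rw [this]
    exact rank_mul_le_right _ _
  -- The first block column already has full rank, so it spans all columns of `Z`.
  have heq := Submodule.eq_of_le_of_finrank_le hle hrank
  have hcol : ∀ j : B, ∃ y : R → F, C *ᵥ y = Z.col (Sum.inr j) := by
    intro j
    have : Z.col (Sum.inr j) ∈ LinearMap.range Z.mulVecLin :=
      ⟨Pi.single (Sum.inr j) 1, by simp⟩
    rw [← heq] at this
    exact this
  choose y hy using hcol
  have hY : fromRows Z.toBlocks₁₂ Z.toBlocks₂₂ = C * (of y)ᵀ := by
    ext i j
    have := congrFun (hy j) i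
    rcases i with i | i <;> exact this.symm
  rw [hC, fromRows_mul] at hY
  obtain ⟨h1, h2⟩ := fromRows_inj hY
  have h3 : Z.toBlocks₁₁⁻¹ * Z.toBlocks₁₂ = (of y)ᵀ := by
    rw [h1, nonsing_inv_mul_cancel_left _ _ hdet]
  rw [lowRank_eq_fromBlocks, Matrix.mul_assoc _ _ Z.toBlocks₁₁, nonsing_inv_mul _ hdet,
    Matrix.mul_one, mul_nonsing_inv_cancel_left _ _ hdet, h3, ← h2, fromBlocks_toBlocks]

theorem exists_equiv_sum_of_injective {m r : ℕ} (σ : Fin r → Fin m) (hσ : Function.Injective σ) :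
    ∃ e : Fin r ⊕ Fin (m - r) ≃ Fin m, ∀ i, e (Sum.inl i) = σ i := by
  classical
  have hc : Fintype.card ↥(Set.range σ)ᶜ = m - r := by
    rw [Fintype.card_compl_set, Set.card_range_of_injective hσ]; simp
  refine ⟨(Equiv.sumCongr (Equiv.ofInjective σ hσ) (Fintype.equivFinOfCardEq hc).symm).trans
    (Equiv.Set.sumCompl (Set.range σ)), fun i => ?_⟩
  simp

theorem exists_linearIndependent_rows {m r : ℕ} {ι : Type*} [Fintype ι] (P : Matrix (Fin m) ι F)
    (hP : P.rank = r) :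
    ∃ σ : Fin r → Fin m, Function.Injective σ ∧ LinearIndependent F (P.submatrix σ id).row := by
  rw [rank_eq_finrank_span_row] at hP
  subst hP
  obtain ⟨f, hf, -, hli⟩ := Submodule.exists_fun_fin_finrank_span_eq F (Set.range P.row)
  choose σ hσ using hf
  have : (P.submatrix σ id).row = f := funext hσ
  refine ⟨σ, fun i j hij => hli.injective ?_, this ▸ hli⟩
  rw [← hσ i, ← hσ j, hij]

/-- Choose `r` independent rows, then `r` independent columns of the resulting submatrix, and extend
both choices to permutations. -/
theorem exists_chart {m n r : ℕ} (P : Matrix (Fin m) (Fin n) F) (hP : P.rank = r) :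
    ∃ (e₁ : Fin r ⊕ Fin (m - r) ≃ Fin m) (e₂ : Fin r ⊕ Fin (n - r) ≃ Fin n),
      IsUnit (P.submatrix e₁ e₂).toBlocks₁₁ := by
  obtain ⟨σ, hσ, h1⟩ := exists_linearIndependent_rows P hP
  obtain ⟨τ, hτ, h2⟩ := exists_linearIndependent_rows (r := r) (P.submatrix σ id)ᵀ
    (by rw [rank_transpose, h1.rank_matrix, Fintype.card_fin])
  obtain ⟨e₁, he₁⟩ := exists_equiv_sum_of_injective σ hσ
  obtain ⟨e₂, he₂⟩ := exists_equiv_sum_of_injective τ hτ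
  refine ⟨e₁, e₂, ?_⟩
  rw [linearIndependent_rows_iff_isUnit, ← isUnit_transpose] at h2
  convert h2 using 1
  ext i j
  simp [toBlocks₁₁, he₁, he₂]

end RankCharts

variable {m n : ℕ}

/-! ### Tangent vectors from curves, and the critical equations they impose. -/

section Tangent

open Matrix

/-- The derivative at `P` of a polynomial in the direction `V`. -/
noncomputable def dirDeriv (P V : Matrix (Fin m) (Fin n) ℂ)
    (f : MvPolynomial (Fin m × Fin n) ℂ) : ℂ :=
  ∑ i, ∑ j, evalAt (MvPolynomial.pderiv (i, j) f) P * V i j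

theorem evalAt_add (f g : MvPolynomial (Fin m × Fin n) ℂ) (P : Matrix (Fin m) (Fin n) ℂ) :
    evalAt (f + g) P = evalAt f P + evalAt g P := map_add _ _ _

theorem evalAt_mul (f g : MvPolynomial (Fin m × Fin n) ℂ) (P : Matrix (Fin m) (Fin n) ℂ) :
    evalAt (f * g) P = evalAt f P * evalAt g P := map_mul _ _ _

theorem evalAt_C (a : ℂ) (P : Matrix (Fin m) (Fin n) ℂ) :
    evalAt (MvPolynomial.C a) P = a := MvPolynomial.eval_C _

theorem evalAt_X (i : Fin m) (j : Fin n) (P : Matrix (Fin m) (Fin n) ℂ) :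
    evalAt (MvPolynomial.X (i, j)) P = P i j := MvPolynomial.eval_X _

theorem dirDeriv_add (P V : Matrix (Fin m) (Fin n) ℂ) (f g : MvPolynomial (Fin m × Fin n) ℂ) :
    dirDeriv P V (f + g) = dirDeriv P V f + dirDeriv P V g := by
  simp only [dirDeriv, map_add, evalAt_add, add_mul, Finset.sum_add_distrib]

theorem dirDeriv_mul (P V : Matrix (Fin m) (Fin n) ℂ) (f g : MvPolynomial (Fin m × Fin n) ℂ) :
    dirDeriv P V (f * g) = evalAt f P * dirDeriv P V g + evalAt g P * dirDeriv P V f := by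
  simp only [dirDeriv, Derivation.leibniz, smul_eq_mul, evalAt_add, evalAt_mul, add_mul,
    Finset.sum_add_distrib, Finset.mul_sum, mul_assoc]

theorem dirDeriv_C (P V : Matrix (Fin m) (Fin n) ℂ) (a : ℂ) :
    dirDeriv P V (MvPolynomial.C a) = 0 := by
  simp [dirDeriv, evalAt]

theorem dirDeriv_X (P V : Matrix (Fin m) (Fin n) ℂ) (i : Fin m) (j : Fin n) :
    dirDeriv P V (MvPolynomial.X (i, j)) = V i j := by
  simp only [dirDeriv, MvPolynomial.pderiv_X, evalAt]
  rw [Finset.sum_eq_single i, Finset.sum_eq_single j]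
  · simp
  · intro k _ hk
    simp [hk]
  · simp
  · intro k _ hk
    simp [hk]
  · simp

theorem dirDeriv_sub (P V : Matrix (Fin m) (Fin n) ℂ) (f g : MvPolynomial (Fin m × Fin n) ℂ) :
    dirDeriv P V (f - g) = dirDeriv P V f - dirDeriv P V g := by
  rw [eq_sub_iff_add_eq, ← dirDeriv_add, sub_add_cancel]

theorem dirDeriv_sum {ι : Type*} (s : Finset ι) (P V : Matrix (Fin m) (Fin n) ℂ)
    (f : ι → MvPolynomial (Fin m × Fin n) ℂ) :
    dirDeriv P V (∑ k ∈ s, f k) = ∑ k ∈ s, dirDeriv P V (f k) := by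
  induction s using Finset.cons_induction with
  | empty => simpa using dirDeriv_C P V 0
  | cons a s ha ih => rw [Finset.sum_cons, Finset.sum_cons, dirDeriv_add, ih]

/-- The chain rule for a polynomial along a curve. -/
theorem hasDerivAt_evalAt_curve {c : ℂ → Matrix (Fin m) (Fin n) ℂ} {V : Matrix (Fin m) (Fin n) ℂ}
    {t : ℂ} (hc : ∀ i j, HasDerivAt (fun t => c t i j) (V i j) t)
    (f : MvPolynomial (Fin m × Fin n) ℂ) :
    HasDerivAt (fun t => evalAt f (c t)) (dirDeriv (c t) V f) t := by
  induction f using MvPolynomial.induction_on with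
  | C a => simpa only [evalAt_C, dirDeriv_C] using hasDerivAt_const t a
  | add p q hp hq => simpa only [evalAt_add, dirDeriv_add] using hp.fun_add hq
  | mul_X p ij hp =>
    obtain ⟨i, j⟩ := ij
    simp only [evalAt_mul, dirDeriv_mul, evalAt_X, dirDeriv_X]
    refine (hp.mul (hc i j)).congr_deriv ?_
    ring

/-- Velocities of curves are tangent vectors. -/
theorem mem_tangentSpaceAt_of_curve {X : Set (Matrix (Fin m) (Fin n) ℂ)}
    {c : ℂ → Matrix (Fin m) (Fin n) ℂ} {V : Matrix (Fin m) (Fin n) ℂ}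
    (hc : ∀ i j, HasDerivAt (fun t => c t i j) (V i j) 0) (hX : ∀ᶠ t in nhds 0, c t ∈ X) :
    V ∈ tangentSpaceAt X (c 0) := by
  intro f hf
  refine (hasDerivAt_evalAt_curve hc f).unique ?_
  refine (hasDerivAt_const (0 : ℂ) (0 : ℂ)).congr_of_eventuallyEq ?_
  filter_upwards [hX] with t ht using hf _ ht

/-- The vector is the velocity at `0` of `(1 + tK) P (1 + tL)` divided by its total; for small `t`
this curve keeps the rank, the total and the non-vanishing entries. -/
theorem mem_tangentSpaceAt_rankVariety {r : ℕ} {P : Matrix (Fin m) (Fin n) ℂ}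
    (hP : P ∈ rankVariety m n r) (K : Matrix (Fin m) (Fin m) ℂ) (L : Matrix (Fin n) (Fin n) ℂ) :
    K * P + P * L - (∑ i, ∑ j, (K * P + P * L) i j) • P ∈
      tangentSpaceAt (rankVariety m n r) P := by
  obtain ⟨h0, h1, hr⟩ := hP
  set V := K * P + P * L with hV
  set B : ℂ → Matrix (Fin m) (Fin n) ℂ := fun t => (1 + t • K) * P * (1 + t • L) with hB
  have hBe : ∀ t i j, B t i j = P i j + t * V i j + t ^ 2 * (K * P * L) i j := by
    intro t i j
    have : B t = P + t • V + t ^ 2 • (K * P * L) := by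
      simp only [hB, hV, Matrix.add_mul, Matrix.mul_add, Matrix.one_mul, Matrix.mul_one, smul_mul,
        Matrix.mul_smul, smul_add, smul_smul, pow_two]
      abel
    rw [this]; rfl
  have hBd : ∀ i j, HasDerivAt (fun t => B t i j) (V i j) 0 := by
    intro i j
    simp only [hBe]
    refine ((((hasDerivAt_id (0 : ℂ)).mul_const (V i j)).const_add (P i j)).add
      (((hasDerivAt_id (0 : ℂ)).pow 2).mul_const ((K * P * L) i j))).congr_deriv ?_
    simp
  have hB0 : B 0 = P := by simp [hB]
  set s : ℂ → ℂ := fun t => ∑ i, ∑ j, B t i j with hs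
  have hsd : HasDerivAt s (∑ i, ∑ j, V i j) 0 :=
    HasDerivAt.fun_sum fun i _ => HasDerivAt.fun_sum fun j _ => hBd i j
  have hs0 : s 0 = 1 := by simp only [hs, hB0, h1]
  have key := mem_tangentSpaceAt_of_curve (X := rankVariety m n r) (c := fun t => (s t)⁻¹ • B t)
    (V := V - (∑ i, ∑ j, V i j) • P) ?_ ?_
  · simpa [hs0, hB0] using key
  · intro i j
    have := (hsd.inv (by rw [hs0]; exact one_ne_zero)).mul (hBd i j)
    refine this.congr_deriv ?_
    simp [hs0, hB0]
    ring
  · have hdet : ∀ (k : ℕ) (K : Matrix (Fin k) (Fin k) ℂ),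
        ∀ᶠ t : ℂ in nhds 0, (1 + t • K).det ≠ 0 := by
      intro k K
      have : Continuous fun t : ℂ => (1 + t • K).det := by fun_prop
      exact this.continuousAt.eventually_ne (by simp)
    have hne : ∀ᶠ t in nhds 0, ∀ i j, B t i j ≠ 0 := by
      refine Filter.eventually_all.2 fun i => Filter.eventually_all.2 fun j => ?_
      exact (hBd i j).continuousAt.eventually_ne (by rw [hB0]; exact h0 i j)
    filter_upwards [hdet m K, hdet n L, hne, hsd.continuousAt.eventually_ne
      (by rw [hs0]; exact one_ne_zero)] with t h2 h3 h4 h5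
    refine ⟨fun i j => mul_ne_zero (inv_ne_zero h5) (h4 i j), ?_, ?_⟩
    · simp only [Matrix.smul_apply, smul_eq_mul, ← Finset.mul_sum]
      exact inv_mul_cancel₀ h5
    · rw [rank_smul_of_mem_nonZeroDivisors _ (mem_nonZeroDivisors_of_ne_zero (inv_ne_zero h5)), hB]
      simp only
      rw [rank_mul_eq_left_of_det_ne_zero _ _ h3, rank_mul_eq_right_of_det_ne_zero _ _ h2, hr]

/-- The entrywise quotient `U / P`, minus the total of `U`. -/
noncomputable def residual (U P : Matrix (Fin m) (Fin n) ℂ) : Matrix (Fin m) (Fin n) ℂ :=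
  Matrix.of fun i j => U i j / P i j - ∑ i', ∑ j', U i' j'

/-- The directions `K * P` and `P * L`, with `K` and `L` running over matrix units, read off the
entries of the two products. -/
theorem residual_mul_transpose_eq_zero {r : ℕ} {U P : Matrix (Fin m) (Fin n) ℂ}
    (hP : P ∈ critFiber (rankVariety m n r) U) :
    residual U P * Pᵀ = 0 ∧ Pᵀ * residual U P = 0 := by
  obtain ⟨hPX, hc⟩ := hP
  have h0 := hPX.1
  -- Subtracting the total of `V` times `P` from `V` has the same effect as subtracting `u_{++}`
  -- from `U / P`: this is where the residual comes from.
  have hform : ∀ V : Matrix (Fin m) (Fin n) ℂ, V - (∑ i, ∑ j, V i j) • P ∈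
      tangentSpaceAt (rankVariety m n r) P → ∑ i, ∑ j, V i j * residual U P i j = 0 := by
    intro V hV
    have h2 := hc _ hV
    have h3 : ∀ i j, (V - (∑ i, ∑ j, V i j) • P) i j / P i j * U i j =
        V i j * (U i j / P i j) - (∑ i, ∑ j, V i j) * U i j := by
      intro i j
      have := h0 i j
      simp only [Matrix.sub_apply, Matrix.smul_apply, smul_eq_mul]
      field_simp
    simp only [h3, Finset.sum_sub_distrib, ← Finset.mul_sum] at h2
    simp only [residual, Matrix.of_apply, mul_sub, Finset.sum_sub_distrib, ← Finset.sum_mul]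
    exact h2
  constructor
  · ext k i
    have := hform _ (by simpa using mem_tangentSpaceAt_rankVariety hPX (Matrix.single k i 1) 0)
    rw [Finset.sum_eq_single k] at this
    · simp only [Matrix.mul_apply, Matrix.transpose_apply, Matrix.zero_apply]
      rw [← this]
      refine Finset.sum_congr rfl fun j _ => ?_
      simp [mul_comm]
    · intro l _ hl
      simp [Matrix.single_mul_apply_of_ne, hl]
    · simp
  · ext j k
    have := hform _ (by simpa using mem_tangentSpaceAt_rankVariety hPX 0 (Matrix.single j k 1))
    rw [Finset.sum_comm, Finset.sum_eq_single k] at this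
    · simp only [Matrix.mul_apply, Matrix.transpose_apply, Matrix.zero_apply]
      rw [← this]
      refine Finset.sum_congr rfl fun j _ => ?_
      simp
    · intro l _ hl
      simp [hl]
    · simp

end Tangent

/-! ### Every tangent vector satisfies the linear chart equations; characterization of critical
points. -/

section Converse

open Matrix MvPolynomial

/-- The polynomial equations of the matrices of rank `card R` in a chart. -/
theorem chart_equation {R A B F : Type*} [Field F] [Fintype R] [Fintype A] [Fintype B]
    [DecidableEq R] [DecidableEq A] [DecidableEq B] {Z : Matrix (R ⊕ A) (R ⊕ B) F}
    (hZ : Z.rank = Fintype.card R) (X : Matrix A R F) (Y : Matrix R B F) :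
    Z.toBlocks₁₁.det ^ 2 • (fromCols (-X) (1 : Matrix A A F) * Z * fromRows (-Y) (1 : Matrix B B F))
      = (Z.toBlocks₂₁ * Z.toBlocks₁₁.adjugate - Z.toBlocks₁₁.det • X) * Z.toBlocks₁₁ *
        (Z.toBlocks₁₁.adjugate * Z.toBlocks₁₂ - Z.toBlocks₁₁.det • Y) := by
  have hsplit : fromCols (-X) (1 : Matrix A A F) * Z * fromRows (-Y) (1 : Matrix B B F) =
      X * Z.toBlocks₁₁ * Y - X * Z.toBlocks₁₂ - Z.toBlocks₂₁ * Y + Z.toBlocks₂₂ := by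
    conv_lhs => rw [← fromBlocks_toBlocks Z]
    rw [fromCols_mul_fromBlocks, fromCols_mul_fromRows]
    simp [Matrix.add_mul]
    abel
  set M := Z.toBlocks₁₁
  set C := Z.toBlocks₂₁
  set D := Z.toBlocks₁₂
  have hR : (C * M.adjugate - M.det • X) * M * (M.adjugate * D - M.det • Y) =
      M.det • (C * M.adjugate * D) - M.det ^ 2 • (C * Y) - M.det ^ 2 • (X * D)
        + M.det ^ 2 • (X * M * Y) := by
    have h1 : (C * M.adjugate - M.det • X) * M = M.det • (C - X * M) := by
      rw [Matrix.sub_mul, Matrix.mul_assoc, adjugate_mul, smul_mul, Matrix.mul_smul, Matrix.mul_one,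
        smul_sub]
    have h2 : X * M * (M.adjugate * D) = M.det • (X * D) := by
      rw [Matrix.mul_assoc, ← Matrix.mul_assoc M, mul_adjugate, smul_mul, Matrix.one_mul,
        Matrix.mul_smul]
    rw [h1, smul_mul, Matrix.mul_sub, Matrix.sub_mul, Matrix.sub_mul, h2, Matrix.mul_smul,
      Matrix.mul_smul, ← Matrix.mul_assoc C]
    simp only [smul_sub, smul_smul, pow_two]
    abel
  rw [hR, hsplit]
  -- Both sides vanish when `M` is singular, so the equation holds on all matrices of the given
  -- rank, not only on those in the chart.
  have hmain : M.det ^ 2 • Z.toBlocks₂₂ = M.det • (C * M.adjugate * D) := by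
    by_cases hdet : M.det = 0
    · simp [hdet]
    · have hM : IsUnit M := (isUnit_iff_isUnit_det _).2 (isUnit_iff_ne_zero.2 hdet)
      have h3 := congrArg toBlocks₂₂ (eq_lowRank hM hZ.le)
      rw [lowRank_eq_fromBlocks, toBlocks_fromBlocks₂₂] at h3
      rw [h3, nonsing_inv_mul_cancel_right _ _ ((isUnit_iff_isUnit_det _).1 hM), inv_def,
        Ring.inverse_eq_inv']
      simp only [Matrix.mul_smul, smul_mul, smul_smul, ← Matrix.mul_assoc]
      congr 1
      change M.det ^ 2 * M.det⁻¹ = M.det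
      field_simp
  simp only [smul_add, smul_sub, hmain]
  abel

variable {S R A B : Type*} [CommRing S] [Fintype R] [DecidableEq R]

/-- The left factor of the quadratic part of the chart equations. -/
def chartLeft (Z : Matrix (R ⊕ A) (R ⊕ B) S) (X : Matrix A R S) : Matrix A R S :=
  Z.toBlocks₂₁ * Z.toBlocks₁₁.adjugate - Z.toBlocks₁₁.det • X

/-- The right factor of the quadratic part of the chart equations. -/
def chartRight (Z : Matrix (R ⊕ A) (R ⊕ B) S) (Y : Matrix R B S) : Matrix R B S :=
  Z.toBlocks₁₁.adjugate * Z.toBlocks₁₂ - Z.toBlocks₁₁.det • Y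

theorem chartLeft_map {S' : Type*} [CommRing S'] (f : S →+* S') (Z : Matrix (R ⊕ A) (R ⊕ B) S)
    (X : Matrix A R S) : (chartLeft Z X).map f = chartLeft (Z.map f) (X.map f) := by
  have h1 : (Z.toBlocks₁₁.map f).adjugate = Z.toBlocks₁₁.adjugate.map f :=
    (f.map_adjugate _).symm
  have h2 : (Z.toBlocks₁₁.map f).det = f Z.toBlocks₁₁.det := (f.map_det _).symm
  have h3 : (Z.map f).toBlocks₁₁ = Z.toBlocks₁₁.map f := rfl
  have h4 : (Z.map f).toBlocks₂₁ = Z.toBlocks₂₁.map f := rfl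
  rw [chartLeft, chartLeft, h3, h4, h1, h2, ← Matrix.map_mul]
  ext i j
  simp only [map_apply, Matrix.sub_apply, Matrix.smul_apply, smul_eq_mul, map_sub, map_mul]

theorem chartRight_map {S' : Type*} [CommRing S'] (f : S →+* S') (Z : Matrix (R ⊕ A) (R ⊕ B) S)
    (Y : Matrix R B S) : (chartRight Z Y).map f = chartRight (Z.map f) (Y.map f) := by
  have h1 : (Z.toBlocks₁₁.map f).adjugate = Z.toBlocks₁₁.adjugate.map f :=
    (f.map_adjugate _).symm
  have h2 : (Z.toBlocks₁₁.map f).det = f Z.toBlocks₁₁.det := (f.map_det _).symm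
  have h3 : (Z.map f).toBlocks₁₁ = Z.toBlocks₁₁.map f := rfl
  have h4 : (Z.map f).toBlocks₁₂ = Z.toBlocks₁₂.map f := rfl
  rw [chartRight, chartRight, h3, h4, h1, h2, ← Matrix.map_mul]
  ext i j
  simp only [map_apply, Matrix.sub_apply, Matrix.smul_apply, smul_eq_mul, map_sub, map_mul]

/-- A term with two factors vanishing at `P` vanishes to second order; this removes the right-hand
side of `chart_equation` after differentiation. -/
theorem dirDeriv_eq_zero_of_mul {P V : Matrix (Fin m) (Fin n) ℂ}
    {f g h : MvPolynomial (Fin m × Fin n) ℂ} (hf : evalAt f P = 0) (hg : evalAt g P = 0) :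
    dirDeriv P V (f * h * g) = 0 := by
  rw [dirDeriv_mul, dirDeriv_mul, evalAt_mul, hf, hg]
  ring

/-- Tangent vectors to the matrices of rank `r`, in a chart. -/
theorem tangentSpaceAt_chart {r a b : ℕ} {P V : Matrix (Fin m) (Fin n) ℂ}
    (hV : V ∈ tangentSpaceAt (rankVariety m n r) P)
    (e₁ : Fin r ⊕ Fin a ≃ Fin m) (e₂ : Fin r ⊕ Fin b ≃ Fin n)
    {X : Matrix (Fin a) (Fin r) ℂ} {Y : Matrix (Fin r) (Fin b) ℂ}
    {M : Matrix (Fin r) (Fin r) ℂ} (hM : IsUnit M)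
    (hPM : P.submatrix e₁ e₂ = lowRank M X Y) :
    fromCols (-X) (1 : Matrix (Fin a) (Fin a) ℂ) * V.submatrix e₁ e₂ *
      fromRows (-Y) (1 : Matrix (Fin b) (Fin b) ℂ) = 0 := by
  let Z : Matrix (Fin r ⊕ Fin a) (Fin r ⊕ Fin b)
      (MvPolynomial (Fin m × Fin n) ℂ) := of fun i j => MvPolynomial.X (e₁ i, e₂ j)
  let L : Matrix (Fin a) (Fin r ⊕ Fin a) ℂ := fromCols (-X) (1 : Matrix (Fin a) (Fin a) ℂ)
  let T : Matrix (Fin r ⊕ Fin b) (Fin b) ℂ := fromRows (-Y) (1 : Matrix (Fin b) (Fin b) ℂ)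
  let E : Matrix (Fin a) (Fin r) (MvPolynomial (Fin m × Fin n) ℂ) := chartLeft Z (X.map C)
  let G : Matrix (Fin r) (Fin b) (MvPolynomial (Fin m × Fin n) ℂ) := chartRight Z (Y.map C)
  have hdet : M.det ≠ 0 := ((isUnit_iff_isUnit_det _).1 hM).ne_zero
  let ev : Matrix (Fin m) (Fin n) ℂ → MvPolynomial (Fin m × Fin n) ℂ →+* ℂ := fun Q =>
    MvPolynomial.eval fun ij => Q ij.1 ij.2
  have hZ : ∀ Q, Z.map (ev Q) = Q.submatrix e₁ e₂ := by
    intro Q; ext i j; simp [Z, ev]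
  have hC : ∀ {k l : ℕ} (N : Matrix (Fin k) (Fin l) ℂ) Q, (N.map C).map (ev Q) = N := by
    intro k l N Q; ext i j; simp [ev]
  have hE : ∀ Q, E.map (ev Q) = chartLeft (Q.submatrix e₁ e₂) X := by
    intro Q; rw [chartLeft_map, hZ, hC]
  have hG : ∀ Q, G.map (ev Q) = chartRight (Q.submatrix e₁ e₂) Y := by
    intro Q; rw [chartRight_map, hZ, hC]
  have hE0 : E.map (ev P) = 0 := by
    rw [hE, hPM, lowRank_eq_fromBlocks, chartLeft]
    simp [Matrix.mul_assoc, mul_adjugate]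
  have hG0 : G.map (ev P) = 0 := by
    rw [hG, hPM, lowRank_eq_fromBlocks, chartRight]
    simp [← Matrix.mul_assoc, adjugate_mul]
  ext i j
  let ℓ : MvPolynomial (Fin m × Fin n) ℂ := ∑ l, (∑ k, C (L i k) * Z k l) * C (T l j)
  let q : MvPolynomial (Fin m × Fin n) ℂ := ∑ l, (∑ k, E i k * Z.toBlocks₁₁ k l) * G l j
  -- One entry of `chart_equation` as a polynomial: `ℓ` is linear and vanishes at `P`, and `q` is of
  -- second order there, so the differential of `F` at `P` is `det M ^ 2` times `ℓ`.
  let F : MvPolynomial (Fin m × Fin n) ℂ := Z.toBlocks₁₁.det ^ 2 * ℓ - q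
  have hℓ : ∀ Q, evalAt ℓ Q = (L * Q.submatrix e₁ e₂ * T) i j := by
    intro Q
    simp [ℓ, evalAt, Matrix.mul_apply, Z]
  have hdZ : ∀ Q, evalAt Z.toBlocks₁₁.det Q = (Q.submatrix e₁ e₂).toBlocks₁₁.det := by
    intro Q
    change ev Q _ = _
    rw [RingHom.map_det, ← hZ]; rfl
  have hF : ∀ Q ∈ rankVariety m n r, evalAt F Q = 0 := by
    intro Q hQ
    have hr : (Q.submatrix e₁ e₂).rank = Fintype.card (Fin r) := by
      rw [rank_submatrix, hQ.2.2, Fintype.card_fin]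
    have h1 := congrFun (congrFun (chart_equation hr X Y) i) j
    have h2 : evalAt q Q = (chartLeft (Q.submatrix e₁ e₂) X * (Q.submatrix e₁ e₂).toBlocks₁₁ *
        chartRight (Q.submatrix e₁ e₂) Y) i j := by
      rw [← hE, ← hG, ← hZ]
      simp [q, evalAt, Matrix.mul_apply, ev, toBlocks₁₁]
    change ev Q (_ - _) = 0
    rw [map_sub, map_mul, map_pow, sub_eq_zero]
    change (evalAt _ Q) ^ 2 * evalAt _ Q = evalAt _ Q
    rw [hℓ, hdZ, h2]
    exact h1
  have hD := hV F hF
  change dirDeriv P V (_ - _) = 0 at hD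
  have hq : dirDeriv P V q = 0 := by
    simp only [q, Finset.sum_mul, dirDeriv_sum]
    refine Finset.sum_eq_zero fun l _ => Finset.sum_eq_zero fun k _ => ?_
    exact dirDeriv_eq_zero_of_mul (congrFun (congrFun hE0 i) k) (congrFun (congrFun hG0 l) j)
  have hℓ0 : evalAt ℓ P = 0 := by
    rw [hℓ, hPM, lowRank, ← Matrix.mul_assoc, ← Matrix.mul_assoc, fromCols_mul_fromRows]
    simp
  have hℓD : dirDeriv P V ℓ = (L * V.submatrix e₁ e₂ * T) i j := by
    simp only [ℓ, dirDeriv_sum, dirDeriv_mul, dirDeriv_C, Matrix.mul_apply, Z, dirDeriv_X,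
      evalAt_C, of_apply, submatrix_apply, mul_zero, add_zero, zero_add, mul_comm (T _ _)]
  rw [dirDeriv_sub, hq, sub_zero, dirDeriv_mul, hℓ0, zero_mul, add_zero, hℓD, pow_two, evalAt_mul,
    hdZ, hPM, lowRank_eq_fromBlocks, toBlocks_fromBlocks₁₁] at hD
  exact (mul_eq_zero.1 hD).resolve_left (mul_ne_zero hdet hdet)

theorem dirDeriv_sum_X_sub_one (P V : Matrix (Fin m) (Fin n) ℂ) :
    dirDeriv P V ((∑ i, ∑ j, X (i, j)) - 1) = ∑ i, ∑ j, V i j := by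
  rw [dirDeriv_sub, ← C_1, dirDeriv_C, sub_zero]
  simp only [dirDeriv_sum, dirDeriv_X]

/-- The critical points on the matrices of rank `r` are the matrices orthogonal to the residual. -/
theorem mem_critFiber_rankVariety_iff {r : ℕ} {U P : Matrix (Fin m) (Fin n) ℂ} :
    P ∈ critFiber (rankVariety m n r) U ↔
      P ∈ rankVariety m n r ∧ residual U P * Pᵀ = 0 ∧ Pᵀ * residual U P = 0 := by
  refine ⟨fun h => ⟨h.1, residual_mul_transpose_eq_zero h⟩, fun ⟨hP, h1, h2⟩ => ⟨hP, ?_⟩⟩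
  intro V hV
  obtain ⟨e₁, e₂, hM⟩ := exists_chart P hP.2.2
  have hZ := eq_lowRank hM (by rw [rank_submatrix, hP.2.2, Fintype.card_fin])
  set X := (P.submatrix e₁ e₂).toBlocks₂₁ * (P.submatrix e₁ e₂).toBlocks₁₁⁻¹
  set Y := (P.submatrix e₁ e₂).toBlocks₁₁⁻¹ * (P.submatrix e₁ e₂).toBlocks₁₂
  have hT := tangentSpaceAt_chart hV e₁ e₂ hM hZ
  have hW := eq_conormal (W := (residual U P).submatrix e₁ e₂) (X := X) (Y := Y) hM
    (by rw [← hZ, transpose_submatrix, submatrix_mul_equiv, h1]; rfl)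
    (by rw [← hZ, transpose_submatrix, submatrix_mul_equiv, h2]; rfl)
  have hsum := sum_mul_conormal _ ((residual U P).submatrix e₁ e₂).toBlocks₂₂ X Y hT
  rw [← hW] at hsum
  simp only [submatrix_apply] at hsum
  rw [Equiv.sum_comp e₁ fun i => ∑ j, V i (e₂ j) * residual U P i (e₂ j)] at hsum
  simp only [fun i => Equiv.sum_comp e₂ fun j => V i j * residual U P i j] at hsum
  -- Differentiating the equation "total one" shows that `V` has total zero, so the constant in the
  -- residual does not contribute.
  have hV1 := hV ((∑ i, ∑ j, MvPolynomial.X (i, j)) - 1) fun Q hQ => by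
    simp [evalAt, hQ.2.1]
  change dirDeriv P V _ = 0 at hV1
  rw [dirDeriv_sum_X_sub_one] at hV1
  simp only [residual, of_apply, mul_sub, Finset.sum_sub_distrib, ← Finset.sum_mul, hV1, zero_mul,
    sub_zero] at hsum
  rw [← hsum]
  refine Finset.sum_congr rfl fun i _ => Finset.sum_congr rfl fun j _ => ?_
  ring

end Converse

/-! ### Dominance of the data map. -/

section Dominance

open MvPolynomial Topology in
/-- Polynomials whose differentials at some point are linearly independent are algebraically
independent. -/
theorem algebraicIndependent_of_deriv {ι κ : Type*} [Fintype ι] [Fintype κ]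
    (hcard : Fintype.card ι = Fintype.card κ) (ψ : κ → MvPolynomial ι ℂ) (z : ι → ℂ)
    (h : ∀ v : ι → ℂ, (∀ k, HasDerivAt (fun t : ℂ => eval (z + t • v) (ψ k)) 0 0) → v = 0) :
    AlgebraicIndependent ℂ ψ := by
  have hk : ∀ k, HasStrictFDerivAt (fun x => eval x (ψ k)) (fderiv ℂ (fun x => eval x (ψ k)) z) z :=
    fun k => (AnalyticOnNhd.eval_mvPolynomial (ψ k) z (Set.mem_univ z)).hasStrictFDerivAt
  have hg := hasStrictFDerivAt_pi.2 hk
  set D := ContinuousLinearMap.pi fun k => fderiv ℂ (fun x => eval x (ψ k)) z with hD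
  have hinj : Function.Injective (D : (ι → ℂ) →ₗ[ℂ] (κ → ℂ)) := by
    rw [injective_iff_map_eq_zero]
    intro v hv
    refine h v fun k => ?_
    have hl : HasDerivAt (fun t : ℂ => z + t • v) v 0 := by
      simpa using ((hasDerivAt_id (0 : ℂ)).smul_const v).const_add z
    have hk' : HasFDerivAt (fun x => eval x (ψ k)) (fderiv ℂ (fun x => eval x (ψ k)) z)
        (z + (0 : ℂ) • v) := by simpa using (hk k).hasFDerivAt
    have := hk'.comp_hasDerivAt (0 : ℂ) hl
    have h0 : fderiv ℂ (fun x => eval x (ψ k)) z v = 0 := congrFun hv k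
    rwa [h0] at this
  have hsurj : Function.Surjective (D : (ι → ℂ) →ₗ[ℂ] (κ → ℂ)) :=
    (LinearMap.injective_iff_surjective_of_finrank_eq_finrank (by simpa using hcard)).1 hinj
  -- The map is open at `z`, so a relation vanishes on a product of balls; these are infinite sets,
  -- so the relation is zero.
  have hnhds := hg.map_nhds_eq_of_surj (LinearMap.range_eq_top.2 hsurj)
  rw [AlgebraicIndependent, injective_iff_map_eq_zero]
  intro F hF
  have hev : ∀ᶠ u in 𝓝 (fun k => eval z (ψ k)), eval u F = 0 := by
    rw [← hnhds, Filter.eventually_map]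
    refine Filter.Eventually.of_forall fun x => ?_
    rw [← eval_aeval_family, hF, map_zero]
  obtain ⟨ε, hε, hball⟩ := Metric.eventually_nhds_iff_ball.1 hev
  refine funext_set (fun k => Metric.ball (eval z (ψ k)) ε)
    (fun k => infinite_of_mem_nhds _ (Metric.ball_mem_nhds _ hε)) fun u hu => ?_
  rw [map_zero]
  refine hball u ?_
  rw [ball_pi _ hε]
  exact hu

open Matrix

variable {S R A B : Type*} [CommRing S] [Fintype R] [Fintype A] [Fintype B]
  [DecidableEq R] [DecidableEq A] [DecidableEq B]

/-- The chart of the variety of critical points: the data for which the low rank matrix with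
parameters `Z` is critical. -/
def dataMap (Z : Matrix (R ⊕ A) (R ⊕ B) S) : Matrix (R ⊕ A) (R ⊕ B) S :=
  of fun i j => lowRank Z.toBlocks₁₁ Z.toBlocks₂₁ Z.toBlocks₁₂ i j *
    (conormal Z.toBlocks₂₂ Z.toBlocks₂₁ Z.toBlocks₁₂ i j + 1)

theorem lowRank_map {S' : Type*} [CommRing S'] (f : S →+* S') (M : Matrix R R S)
    (X : Matrix A R S) (Y : Matrix R B S) :
    (lowRank M X Y).map f = lowRank (M.map f) (X.map f) (Y.map f) := by
  have h1 : (1 : Matrix R R S).map f = 1 := Matrix.map_one _ (map_zero f) (map_one f)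
  rw [lowRank, lowRank, Matrix.map_mul, Matrix.map_mul, fromRows_map, fromCols_map, h1]

theorem conormal_map {S' : Type*} [CommRing S'] (f : S →+* S') (N : Matrix A B S)
    (X : Matrix A R S) (Y : Matrix R B S) :
    (conormal N X Y).map f = conormal (N.map f) (X.map f) (Y.map f) := by
  have h1 : (1 : Matrix A A S).map f = 1 := Matrix.map_one _ (map_zero f) (map_one f)
  have h2 : (1 : Matrix B B S).map f = 1 := Matrix.map_one _ (map_zero f) (map_one f)
  have h3 : (-X).map f = -(X.map f) := by ext; simp
  have h4 : (-Y).map f = -(Y.map f) := by ext; simp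
  rw [conormal, conormal, Matrix.map_mul, Matrix.map_mul, transpose_map, transpose_map,
    fromRows_map, fromCols_map, h1, h2, h3, h4]

theorem dataMap_map {S' : Type*} [CommRing S'] (f : S →+* S') (Z : Matrix (R ⊕ A) (R ⊕ B) S) :
    (dataMap Z).map f = dataMap (Z.map f) := by
  ext i j
  have h1 := congrFun (congrFun (lowRank_map f Z.toBlocks₁₁ Z.toBlocks₂₁ Z.toBlocks₁₂) i) j
  have h2 := congrFun (congrFun
    (conormal_map f Z.toBlocks₂₂ Z.toBlocks₂₁ Z.toBlocks₁₂) i) j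
  rw [map_apply] at h1 h2
  simp only [dataMap, map_apply, of_apply, map_mul, map_add, map_one, h1, h2]
  rfl

theorem HasDerivAt.matrix_mul {k l p : Type*} [Fintype l] {F : ℂ → Matrix k l ℂ}
    {G : ℂ → Matrix l p ℂ} {F' : Matrix k l ℂ} {G' : Matrix l p ℂ} {t : ℂ}
    (hF : ∀ i j, HasDerivAt (fun s => F s i j) (F' i j) t)
    (hG : ∀ i j, HasDerivAt (fun s => G s i j) (G' i j) t) (i : k) (j : p) :
    HasDerivAt (fun s => (F s * G s) i j) ((F' * G t + F t * G') i j) t := by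
  simp only [Matrix.mul_apply, Matrix.add_apply, ← Finset.sum_add_distrib]
  exact HasDerivAt.fun_sum fun x _ => (hF i x).mul (hG x j)

/-- The derivative of `lowRank`. -/
def lowRankDeriv (M M' : Matrix R R S) (X X' : Matrix A R S) (Y Y' : Matrix R B S) :
    Matrix (R ⊕ A) (R ⊕ B) S :=
  (fromRows (0 : Matrix R R S) X' * M + fromRows (1 : Matrix R R S) X * M') *
      fromCols (1 : Matrix R R S) Y +
    fromRows (1 : Matrix R R S) X * M * fromCols (0 : Matrix R R S) Y'

theorem hasDerivAt_lowRank (M M' : Matrix R R ℂ) (X X' : Matrix A R ℂ) (Y Y' : Matrix R B ℂ)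
    (i : R ⊕ A) (j : R ⊕ B) :
    HasDerivAt (fun t : ℂ => lowRank (M + t • M') (X + t • X') (Y + t • Y') i j)
      (lowRankDeriv M M' X X' Y Y' i j) 0 := by
  have hlin : ∀ a b : ℂ, HasDerivAt (fun t : ℂ => a + t * b) b 0 := fun a b => by
    simpa using ((hasDerivAt_id (0 : ℂ)).mul_const b).const_add a
  have h1 : ∀ i j, HasDerivAt (fun t : ℂ => fromRows (1 : Matrix R R ℂ) (X + t • X') i j)
      (fromRows (0 : Matrix R R ℂ) X' i j) 0 := by
    rintro (i | i) j
    · exact hasDerivAt_const _ _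
    · exact hlin _ _
  have h2 : ∀ i j, HasDerivAt (fun t : ℂ => (M + t • M') i j) (M' i j) 0 := fun i j => hlin _ _
  have h3 : ∀ i j, HasDerivAt (fun t : ℂ => fromCols (1 : Matrix R R ℂ) (Y + t • Y') i j)
      (fromCols (0 : Matrix R R ℂ) Y' i j) 0 := by
    rintro i (j | j)
    · exact hasDerivAt_const _ _
    · exact hlin _ _
  have := HasDerivAt.matrix_mul (HasDerivAt.matrix_mul h1 h2) h3 i j
  simp only [zero_smul, add_zero] at this
  exact this

/-- The derivative of `conormal` at a point where it vanishes. -/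
theorem hasDerivAt_conormal (N : Matrix A B ℂ) (X X' : Matrix A R ℂ) (Y Y' : Matrix R B ℂ)
    (i : R ⊕ A) (j : R ⊕ B) :
    HasDerivAt (fun t : ℂ => conormal (t • N) (X + t • X') (Y + t • Y') i j)
      (conormal N X Y i j) 0 := by
  have : ∀ t : ℂ, conormal (t • N) (X + t • X') (Y + t • Y') i j =
      t * conormal N (X + t • X') (Y + t • Y') i j := by
    intro t
    rw [conormal, conormal, Matrix.mul_smul, smul_mul, Matrix.smul_apply, smul_eq_mul]
  simp only [this]
  have hc : Continuous fun t : ℂ => conormal N (X + t • X') (Y + t • Y') i j := by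
    simp only [conormal_eq_fromBlocks]
    rcases i with i | i <;> rcases j with j | j <;>
      simp only [fromBlocks_apply₁₁, fromBlocks_apply₁₂, fromBlocks_apply₂₁, fromBlocks_apply₂₂,
        Matrix.neg_apply, Matrix.mul_apply, transpose_apply, Matrix.add_apply,
        Matrix.smul_apply] <;>
      fun_prop
  rw [hasDerivAt_iff_tendsto_slope_zero]
  have h := hc.tendsto 0
  simp only [zero_smul, add_zero] at h
  refine (h.mono_left nhdsWithin_le_nhds).congr' ?_
  filter_upwards [self_mem_nhdsWithin] with t ht
  have : t ≠ 0 := ht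
  simp only [zero_add, zero_mul, sub_zero, smul_eq_mul]
  field_simp

/-- Each summand of the derivative retains one of the two outer factors, which the kernel matrices
annihilate. By `sum_mul_conormal`, tangent vectors of the chart then pair to zero with conormal
ones. -/
theorem kernel_mul_lowRankDeriv (M M' : Matrix R R S) (X X' : Matrix A R S) (Y Y' : Matrix R B S) :
    fromCols (-X) (1 : Matrix A A S) * lowRankDeriv M M' X X' Y Y' *
      fromRows (-Y) (1 : Matrix B B S) = 0 := by
  have h1 : fromCols (-X) (1 : Matrix A A S) * fromRows (1 : Matrix R R S) X = 0 := by
    simp [fromCols_mul_fromRows]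
  have h2 : fromCols (1 : Matrix R R S) Y * fromRows (-Y) (1 : Matrix B B S) = 0 := by
    simp [fromCols_mul_fromRows]
  rw [lowRankDeriv, Matrix.mul_add, Matrix.add_mul, Matrix.mul_assoc,
    Matrix.mul_assoc _ _ (fromRows (-Y) _), h2, Matrix.mul_zero, Matrix.mul_zero, zero_add,
    Matrix.mul_assoc (fromRows 1 X), ← Matrix.mul_assoc _ (fromRows 1 X), h1,
    Matrix.zero_mul, Matrix.zero_mul]

theorem lowRankDeriv_eq_zero {M M' : Matrix R R S} (hM : IsUnit M) {X X' : Matrix A R S}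
    {Y Y' : Matrix R B S} (h : lowRankDeriv M M' X X' Y Y' = 0) : M' = 0 ∧ X' = 0 ∧ Y' = 0 := by
  obtain ⟨L, hL1, hL2⟩ := isUnit_iff_exists.1 hM
  have hb : lowRankDeriv M M' X X' Y Y' = fromBlocks M' (M' * Y + M * Y') (X' * M + X * M')
      ((X' * M + X * M') * Y + X * M * Y') := by
    simp only [lowRankDeriv, fromRows_mul, mul_fromCols, Matrix.mul_one, Matrix.zero_mul,
      Matrix.one_mul, Matrix.mul_zero, Matrix.add_mul]
    ext (i | i) (j | j) <;> simp
  rw [hb, ← fromBlocks_zero, fromBlocks_inj] at h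
  obtain ⟨h1, h2, h3, -⟩ := h
  refine ⟨h1, ?_, ?_⟩
  · rw [h1, Matrix.mul_zero, add_zero] at h3
    rw [← Matrix.mul_one X', ← hL1, ← Matrix.mul_assoc, h3, Matrix.zero_mul]
  · rw [h1, Matrix.zero_mul, zero_add] at h2
    rw [← Matrix.one_mul Y', ← hL2, Matrix.mul_assoc, h2, Matrix.mul_zero]

/-- By the matrix determinant lemma the determinant is `card R + 1`. This block is the base point
for dominance: invertible like the identity, but with positive entries. -/
theorem isUnit_one_add_ones : IsUnit (1 + of fun _ _ => 1 : Matrix R R ℂ) := by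
  rw [isUnit_iff_isUnit_det]
  have : (of fun _ _ => 1 : Matrix R R ℂ) =
      replicateCol Unit (fun _ : R => (1 : ℂ)) * replicateRow Unit (fun _ : R => (1 : ℂ)) := by
    ext; simp [Matrix.mul_apply]
  rw [this, det_one_add_replicateCol_mul_replicateRow, isUnit_iff_ne_zero]
  simp only [dotProduct, mul_one, Finset.sum_const, Finset.card_univ, nsmul_eq_mul]
  rw [add_comm]
  exact Nat.cast_add_one_ne_zero _

theorem lowRank_ones_pos [Nonempty R] (i : R ⊕ A) (j : R ⊕ B) :
    ∃ p : ℝ, 0 < p ∧ lowRank (1 + of fun _ _ => 1 : Matrix R R ℂ) (of fun _ _ => 1)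
      (of fun _ _ => 1) i j = p := by
  have hM : ∀ i j : R, 0 < (1 + of fun _ _ => 1 : Matrix R R ℝ) i j := by
    intro i j
    by_cases h : i = j <;> simp [h]
  refine ⟨lowRank (1 + of fun _ _ => 1 : Matrix R R ℝ) (of fun _ _ => 1) (of fun _ _ => 1) i j,
    ?_, ?_⟩
  · rw [lowRank_eq_fromBlocks]
    have hs : ∀ f : R → ℝ, (∀ k, 0 < f k) → 0 < ∑ k, f k := fun f hf =>
      Finset.sum_pos (fun k _ => hf k) Finset.univ_nonempty
    rcases i with i | i <;> rcases j with j | j <;>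
      simp only [fromBlocks_apply₁₁, fromBlocks_apply₁₂, fromBlocks_apply₂₁, fromBlocks_apply₂₂,
        Matrix.mul_apply, of_apply, mul_one, one_mul]
    · exact hM i j
    · exact hs _ fun k => hM _ _
    · exact hs _ fun k => hM _ _
    · exact hs _ fun k => hs _ fun l => hM _ _
  · have := congrFun (congrFun (lowRank_map Complex.ofRealHom
      (1 + of fun _ _ => 1 : Matrix R R ℝ) (of fun _ _ => 1 : Matrix A R ℝ)
      (of fun _ _ => 1 : Matrix R B ℝ)) i) j
    rw [map_apply] at this
    refine Eq.trans ?_ this.symm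
    congr 1
    · ext k l
      by_cases h : k = l <;> simp [h]

variable {κ₁ κ₂ : Type*}

/-- The chart of the variety of critical points, as a family of polynomials. -/
noncomputable def chartMap (e₁ : R ⊕ A ≃ κ₁) (e₂ : R ⊕ B ≃ κ₂) (k : κ₁ × κ₂) :
    MvPolynomial ((R ⊕ A) × (R ⊕ B)) ℂ :=
  dataMap (mvPolynomialX (R ⊕ A) (R ⊕ B) ℂ) (e₁.symm k.1) (e₂.symm k.2)

theorem map_eval_mvPolynomialX (x : (R ⊕ A) × (R ⊕ B) → ℂ) :
    (mvPolynomialX (R ⊕ A) (R ⊕ B) ℂ).map (MvPolynomial.eval x) = of fun i j => x (i, j) := by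
  ext i j; simp

theorem eval_chartMap (e₁ : R ⊕ A ≃ κ₁) (e₂ : R ⊕ B ≃ κ₂) (k : κ₁ × κ₂)
    (x : (R ⊕ A) × (R ⊕ B) → ℂ) : MvPolynomial.eval x (chartMap e₁ e₂ k) =
      dataMap (of fun i j => x (i, j)) (e₁.symm k.1) (e₂.symm k.2) := by
  rw [← map_eval_mvPolynomialX, ← dataMap_map]; rfl

/-- The base point has `M = 1 + ones`, `X` and `Y` all ones, and `N = 0`, so that the low rank
matrix `p` is positive and the conormal matrix vanishes. A kernel vector of the differential yields
`P' + p W' = 0` entrywise, with `P'` tangent and `W'` conormal. Pairing the conjugate of `P'` with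
`W'` gives `∑ |P'|² / p = 0`, hence `P' = 0` and `W' = 0`, and the parameters vanish in turn. -/
theorem algebraicIndependent_chartMap [Fintype κ₁] [Fintype κ₂] [Nonempty R] (e₁ : R ⊕ A ≃ κ₁)
    (e₂ : R ⊕ B ≃ κ₂) : AlgebraicIndependent ℂ (chartMap e₁ e₂) := by
  set M : Matrix R R ℂ := 1 + of fun _ _ => 1 with hM
  set X : Matrix A R ℂ := of fun _ _ => 1 with hX
  set Y : Matrix R B ℂ := of fun _ _ => 1 with hY
  refine algebraicIndependent_of_deriv (Fintype.card_congr (e₁.prodCongr e₂)) _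
    (fun p => fromBlocks M Y X 0 p.1 p.2) fun v hv => ?_
  set V : Matrix (R ⊕ A) (R ⊕ B) ℂ := of fun i j => v (i, j) with hV
  set P' := lowRankDeriv M V.toBlocks₁₁ X V.toBlocks₂₁ Y V.toBlocks₁₂ with hP'
  set W' := conormal V.toBlocks₂₂ X Y with hW'
  have hzero : ∀ i j, P' i j + lowRank M X Y i j * W' i j = 0 := by
    intro i j
    have h1 := hv (e₁ i, e₂ j)
    simp only [eval_chartMap, Equiv.symm_apply_apply] at h1
    have h2 : ∀ t : ℂ, dataMap (of fun i' j' => ((fun p : (R ⊕ A) × (R ⊕ B) =>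
        fromBlocks M Y X 0 p.1 p.2) + t • v) (i', j')) i j =
        lowRank (M + t • V.toBlocks₁₁) (X + t • V.toBlocks₂₁) (Y + t • V.toBlocks₁₂) i j *
        (conormal (t • V.toBlocks₂₂) (X + t • V.toBlocks₂₁) (Y + t • V.toBlocks₁₂) i j + 1) := by
      intro t
      have h22 : t • V.toBlocks₂₂ = 0 + t • V.toBlocks₂₂ := (zero_add _).symm
      rw [h22]; rfl
    simp only [h2] at h1
    have h3 := (hasDerivAt_lowRank M V.toBlocks₁₁ X V.toBlocks₂₁ Y V.toBlocks₁₂ i j).mul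
      ((hasDerivAt_conormal V.toBlocks₂₂ X V.toBlocks₂₁ Y V.toBlocks₁₂ i j).add_const 1)
    have h4 := h3.unique h1
    have h5 : conormal (0 : Matrix A B ℂ) X Y = 0 := by
      rw [conormal, Matrix.mul_zero, Matrix.zero_mul]
    simpa [h5] using h4
  -- Because `X` and `Y` are real, conjugation preserves the tangent condition.
  have hconj : fromCols (-X) (1 : Matrix A A ℂ) * P'.map (starRingEnd ℂ) *
      fromRows (-Y) (1 : Matrix B B ℂ) = 0 := by
    have h1 : (fromCols (-X) (1 : Matrix A A ℂ)).map (starRingEnd ℂ) = fromCols (-X) 1 := by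
      rw [fromCols_map, Matrix.map_one _ (map_zero _) (map_one _)]
      congr 1; ext; simp [hX]
    have h2 : (fromRows (-Y) (1 : Matrix B B ℂ)).map (starRingEnd ℂ) = fromRows (-Y) 1 := by
      rw [fromRows_map, Matrix.map_one _ (map_zero _) (map_one _)]
      congr 1; ext; simp [hY]
    rw [← h1, ← h2, ← Matrix.map_mul, ← Matrix.map_mul, hP', kernel_mul_lowRankDeriv]
    ext; simp
  have hsum := sum_mul_conormal _ V.toBlocks₂₂ X Y hconj
  have hP0 : P' = 0 := by
    choose p hp hpe using lowRank_ones_pos (R := R) (A := A) (B := B)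
    have hterm : ∀ i j, P'.map (starRingEnd ℂ) i j * W' i j =
        ((-(Complex.normSq (P' i j) / p i j) : ℝ) : ℂ) := by
      intro i j
      have h1 := hzero i j
      rw [hpe i j] at h1
      have h2 : (p i j : ℂ) ≠ 0 := by exact_mod_cast (hp i j).ne'
      have h3 : W' i j = -(P' i j) / p i j := by
        field_simp; linear_combination h1
      rw [h3, map_apply]
      push_cast
      rw [Complex.normSq_eq_conj_mul_self]
      ring
    simp only [← hW', hterm] at hsum
    norm_cast at hsum
    simp only [Finset.sum_neg_distrib, neg_eq_zero] at hsum
    have hnn : ∀ i j, 0 ≤ Complex.normSq (P' i j) / p i j := fun i j =>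
      div_nonneg (Complex.normSq_nonneg _) (hp i j).le
    ext i j
    have h1 := (Finset.sum_eq_zero_iff_of_nonneg fun i _ => Finset.sum_nonneg fun j _ => hnn i j).1
      hsum i (Finset.mem_univ i)
    have h2 := (Finset.sum_eq_zero_iff_of_nonneg fun j _ => hnn i j).1 h1 j (Finset.mem_univ j)
    rw [div_eq_zero_iff, or_iff_left (hp i j).ne'] at h2
    exact Complex.normSq_eq_zero.1 h2
  have hW0 : W' = 0 := by
    ext i j
    obtain ⟨p, hp, hpe⟩ := lowRank_ones_pos (R := R) i j
    have h1 := hzero i j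
    rw [hpe, hP0, Matrix.zero_apply, zero_add] at h1
    exact (mul_eq_zero.1 h1).resolve_left (by exact_mod_cast hp.ne')
  have h22 : V.toBlocks₂₂ = 0 := by
    have := congrArg toBlocks₂₂ hW0
    rw [hW', conormal_eq_fromBlocks, toBlocks_fromBlocks₂₂] at this
    exact this
  obtain ⟨h11, h21, h12⟩ := lowRankDeriv_eq_zero isUnit_one_add_ones hP0
  have hV0 : V = 0 := by
    rw [← fromBlocks_toBlocks V, h11, h12, h21, h22, fromBlocks_zero]
  funext ⟨i, j⟩
  exact congrFun (congrFun hV0 i) j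

end Dominance

/-! ### Critical points in a chart as points in a fibre of the data map. -/

section Fibre

open Matrix

variable {m n r a b : ℕ}

/-- The total of a matrix of data. -/
def total (U : Matrix (Fin m) (Fin n) ℂ) : ℂ := ∑ i, ∑ j, U i j

theorem residual_apply (U P : Matrix (Fin m) (Fin n) ℂ) (i : Fin m) (j : Fin n) :
    residual U P i j = U i j / P i j - total U := rfl

theorem sum_sum_submatrix (e₁ : Fin r ⊕ Fin a ≃ Fin m) (e₂ : Fin r ⊕ Fin b ≃ Fin n)
    (U : Matrix (Fin m) (Fin n) ℂ) : ∑ i, ∑ j, U.submatrix e₁ e₂ i j = total U := by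
  simp only [submatrix_apply, total]
  rw [Equiv.sum_comp e₁ fun i => ∑ j, U i (e₂ j)]
  exact Finset.sum_congr rfl fun i _ => Equiv.sum_comp e₂ fun j => U i j

/-- A low rank matrix pairs to zero with its own conormal matrices. Hence the unnormalized matrix
has total `u_{++}`, and dividing by it gives total one. -/
theorem sum_lowRank_eq_sum_dataMap {R A B : Type*} [Fintype R] [Fintype A] [Fintype B]
    [DecidableEq R] [DecidableEq A] [DecidableEq B] (Z : Matrix (R ⊕ A) (R ⊕ B) ℂ) :
    ∑ i, ∑ j, lowRank Z.toBlocks₁₁ Z.toBlocks₂₁ Z.toBlocks₁₂ i j = ∑ i, ∑ j, dataMap Z i j := by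
  have hV : fromCols (-Z.toBlocks₂₁) (1 : Matrix A A ℂ) *
      lowRank Z.toBlocks₁₁ Z.toBlocks₂₁ Z.toBlocks₁₂ *
      fromRows (-Z.toBlocks₁₂) (1 : Matrix B B ℂ) = 0 := by
    rw [lowRank, ← Matrix.mul_assoc, ← Matrix.mul_assoc, fromCols_mul_fromRows]
    simp
  have := sum_mul_conormal _ Z.toBlocks₂₂ _ _ hV
  simp only [dataMap, of_apply, mul_add, mul_one, Finset.sum_add_distrib, this, zero_add]

theorem lowRank_smul {R A B : Type*} [Fintype R] [DecidableEq R] (c : ℂ) (M : Matrix R R ℂ)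
    (X : Matrix A R ℂ) (Y : Matrix R B ℂ) : lowRank (c • M) X Y = c • lowRank M X Y := by
  rw [lowRank, lowRank, Matrix.mul_smul, smul_mul]

theorem conormal_smul {R A B : Type*} [Fintype A] [Fintype B] [DecidableEq A] [DecidableEq B]
    (c : ℂ) (N : Matrix A B ℂ) (X : Matrix A R ℂ) (Y : Matrix R B ℂ) :
    conormal (c • N) X Y = c • conormal N X Y := by
  rw [conormal, conormal, Matrix.mul_smul, smul_mul]

/-- The low rank matrix of total one with given parameters in a chart. -/
noncomputable def chartPoint (e₁ : Fin r ⊕ Fin a ≃ Fin m) (e₂ : Fin r ⊕ Fin b ≃ Fin n) (u : ℂ)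
    (Z : Matrix (Fin r ⊕ Fin a) (Fin r ⊕ Fin b) ℂ) : Matrix (Fin m) (Fin n) ℂ :=
  (u⁻¹ • lowRank Z.toBlocks₁₁ Z.toBlocks₂₁ Z.toBlocks₁₂).submatrix e₁.symm e₂.symm

/-- A point in the fibre of the chart map yields a critical point. -/
theorem chartPoint_mem_critFiber (e₁ : Fin r ⊕ Fin a ≃ Fin m) (e₂ : Fin r ⊕ Fin b ≃ Fin n)
    {U : Matrix (Fin m) (Fin n) ℂ} (hU : ∀ i j, U i j ≠ 0) (hu : total U ≠ 0)
    {Z : Matrix (Fin r ⊕ Fin a) (Fin r ⊕ Fin b) ℂ} (hZ : dataMap Z = U.submatrix e₁ e₂)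
    (hM : IsUnit Z.toBlocks₁₁) :
    chartPoint e₁ e₂ (total U) Z ∈ critFiber (rankVariety m n r) U ∧
      (residual U (chartPoint e₁ e₂ (total U) Z)).submatrix e₁ e₂ =
        total U • conormal Z.toBlocks₂₂ Z.toBlocks₂₁ Z.toBlocks₁₂ := by
  set u := total U with hu_def
  set L := lowRank Z.toBlocks₁₁ Z.toBlocks₂₁ Z.toBlocks₁₂ with hL
  set P := chartPoint e₁ e₂ u Z with hP
  have hPs : P.submatrix e₁ e₂ = u⁻¹ • L := by
    ext i j; simp [hP, chartPoint, hL]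
  have hUZ : ∀ i j, U (e₁ i) (e₂ j) =
      L i j * (conormal Z.toBlocks₂₂ Z.toBlocks₂₁ Z.toBlocks₁₂ i j + 1) := fun i j =>
    (congrFun (congrFun hZ i) j).symm
  have hL0 : ∀ i j, L i j ≠ 0 := by
    intro i j h0
    apply hU (e₁ i) (e₂ j)
    rw [hUZ, h0, zero_mul]
  have hPe : ∀ i j, P (e₁ i) (e₂ j) = u⁻¹ * L i j := fun i j => congrFun (congrFun hPs i) j
  have hres : (residual U P).submatrix e₁ e₂ =
      u • conormal Z.toBlocks₂₂ Z.toBlocks₂₁ Z.toBlocks₁₂ := by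
    ext i j
    rw [submatrix_apply, residual_apply, hUZ, hPe, ← hu_def, Matrix.smul_apply, smul_eq_mul]
    have := hL0 i j
    field_simp
    ring
  have hrank : P.rank = r := by
    rw [← rank_submatrix P e₁ e₂, hPs,
      rank_smul_of_mem_nonZeroDivisors _ (mem_nonZeroDivisors_of_ne_zero (inv_ne_zero hu)),
      hL, rank_lowRank hM, Fintype.card_fin]
  refine ⟨mem_critFiber_rankVariety_iff.2 ⟨⟨?_, ?_, hrank⟩, ?_, ?_⟩, hres⟩
  · intro i j
    obtain ⟨i, rfl⟩ := e₁.surjective i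
    obtain ⟨j, rfl⟩ := e₂.surjective j
    rw [hPe]
    exact mul_ne_zero (inv_ne_zero hu) (hL0 i j)
  · change total P = 1
    rw [← sum_sum_submatrix e₁ e₂, hPs]
    simp only [Matrix.smul_apply, smul_eq_mul, ← Finset.mul_sum]
    rw [hL, sum_lowRank_eq_sum_dataMap, hZ, sum_sum_submatrix, ← hu_def, inv_mul_cancel₀ hu]
  · have : (residual U P * Pᵀ).submatrix e₁ e₁ = 0 := by
      rw [← submatrix_mul_equiv _ _ _ e₂, hres, ← transpose_submatrix, hPs, transpose_smul,
        smul_mul, Matrix.mul_smul, hL, conormal_mul_lowRank_transpose, smul_zero, smul_zero]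
    ext i j
    simpa using congrFun (congrFun this (e₁.symm i)) (e₁.symm j)
  · have : (Pᵀ * residual U P).submatrix e₂ e₂ = 0 := by
      rw [← submatrix_mul_equiv _ _ _ e₁, hres, ← transpose_submatrix, hPs, transpose_smul,
        smul_mul, Matrix.mul_smul, hL, lowRank_transpose_mul_conormal, smul_zero, smul_zero]
    ext i j
    simpa using congrFun (congrFun this (e₂.symm i)) (e₂.symm j)

/-- A critical point in a chart comes from a point in the fibre of the chart map. -/
theorem exists_chartPoint_eq (e₁ : Fin r ⊕ Fin a ≃ Fin m) (e₂ : Fin r ⊕ Fin b ≃ Fin n)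
    {U : Matrix (Fin m) (Fin n) ℂ} (hu : total U ≠ 0) {P : Matrix (Fin m) (Fin n) ℂ}
    (hP : P ∈ critFiber (rankVariety m n r) U) (hM : IsUnit (P.submatrix e₁ e₂).toBlocks₁₁) :
    ∃ Z, dataMap Z = U.submatrix e₁ e₂ ∧ IsUnit Z.toBlocks₁₁ ∧
      chartPoint e₁ e₂ (total U) Z = P := by
  obtain ⟨hPX, h1, h2⟩ := mem_critFiber_rankVariety_iff.1 hP
  set u := total U with hu_def
  have hL := eq_lowRank hM (by rw [rank_submatrix, hPX.2.2, Fintype.card_fin])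
  set M := (P.submatrix e₁ e₂).toBlocks₁₁
  set X := (P.submatrix e₁ e₂).toBlocks₂₁ * M⁻¹
  set Y := M⁻¹ * (P.submatrix e₁ e₂).toBlocks₁₂
  have hW := eq_conormal (W := (residual U P).submatrix e₁ e₂) (X := X) (Y := Y) hM
    (by rw [← hL, transpose_submatrix, submatrix_mul_equiv, h1]; rfl)
    (by rw [← hL, transpose_submatrix, submatrix_mul_equiv, h2]; rfl)
  set N := ((residual U P).submatrix e₁ e₂).toBlocks₂₂
  -- The chart works with `u P` and `R / u`, so that `U = (u P)(R / u + 1)` entrywise.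
  refine ⟨fromBlocks (u • M) Y X (u⁻¹ • N), ?_, ?_, ?_⟩
  · ext i j
    simp only [dataMap, of_apply, toBlocks_fromBlocks₁₁, toBlocks_fromBlocks₁₂,
      toBlocks_fromBlocks₂₁, toBlocks_fromBlocks₂₂, lowRank_smul, conormal_smul, ← hW, ← hL,
      Matrix.smul_apply, submatrix_apply, smul_eq_mul, residual_apply, ← hu_def]
    have := hPX.1 (e₁ i) (e₂ j)
    field_simp
    ring
  · rw [toBlocks_fromBlocks₁₁, isUnit_iff_isUnit_det, det_smul]
    exact ((isUnit_iff_ne_zero.2 hu).pow _).mul ((isUnit_iff_isUnit_det _).1 hM)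
  · rw [chartPoint, toBlocks_fromBlocks₁₁, toBlocks_fromBlocks₁₂, toBlocks_fromBlocks₂₁,
      lowRank_smul, inv_smul_smul₀ hu, ← hL]
    ext i j
    simp

/-- The point determines `M`, `X` and `Y`; its residual determines `N`. -/
theorem chartPoint_injective (e₁ : Fin r ⊕ Fin a ≃ Fin m) (e₂ : Fin r ⊕ Fin b ≃ Fin n)
    {U : Matrix (Fin m) (Fin n) ℂ} (hU : ∀ i j, U i j ≠ 0) (hu : total U ≠ 0)
    {Z Z' : Matrix (Fin r ⊕ Fin a) (Fin r ⊕ Fin b) ℂ} (hZ : dataMap Z = U.submatrix e₁ e₂)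
    (hZ' : dataMap Z' = U.submatrix e₁ e₂) (hM : IsUnit Z.toBlocks₁₁) (hM' : IsUnit Z'.toBlocks₁₁)
    (h : chartPoint e₁ e₂ (total U) Z = chartPoint e₁ e₂ (total U) Z') : Z = Z' := by
  have h1 := (chartPoint_mem_critFiber e₁ e₂ hU hu hZ hM).2
  have h2 := (chartPoint_mem_critFiber e₁ e₂ hU hu hZ' hM').2
  rw [h, h2] at h1
  have h3 := smul_right_injective _ hu h1
  have h4 : lowRank Z.toBlocks₁₁ Z.toBlocks₂₁ Z.toBlocks₁₂ =
      lowRank Z'.toBlocks₁₁ Z'.toBlocks₂₁ Z'.toBlocks₁₂ := by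
    apply smul_right_injective _ (inv_ne_zero hu)
    ext i j
    simpa [chartPoint] using congrFun (congrFun h (e₁ i)) (e₂ j)
  rw [lowRank_eq_fromBlocks, lowRank_eq_fromBlocks, fromBlocks_inj] at h4
  rw [conormal_eq_fromBlocks, conormal_eq_fromBlocks, fromBlocks_inj] at h3
  obtain ⟨h11, h12, h21, -⟩ := h4
  have hdet := (isUnit_iff_isUnit_det _).1 hM'
  rw [h11] at h12 h21
  have h12' : Z.toBlocks₁₂ = Z'.toBlocks₁₂ := by
    simpa [nonsing_inv_mul_cancel_left _ _ hdet] using congrArg (Z'.toBlocks₁₁⁻¹ * ·) h12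
  have h21' : Z.toBlocks₂₁ = Z'.toBlocks₂₁ := by
    simpa [mul_nonsing_inv_cancel_right _ _ hdet] using congrArg (· * Z'.toBlocks₁₁⁻¹) h21
  rw [← fromBlocks_toBlocks Z, h11, h12', h21', ← h3.2.2.2, fromBlocks_toBlocks]

end Fibre

/-! ### Genericity of charts and residual ranks; existence of the ML-degree. -/

section Generic

open Matrix MvPolynomial

variable {m n r a b : ℕ}

/-- In general position, the parameters of the critical points in a chart avoid a hypersurface. -/
theorem exists_generic_chart (e₁ : Fin r ⊕ Fin a ≃ Fin m) (e₂ : Fin r ⊕ Fin b ≃ Fin n)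
    {h : MvPolynomial ((Fin r ⊕ Fin a) × (Fin r ⊕ Fin b)) ℂ} (hh : h ≠ 0) :
    ∃ F : MvPolynomial (Fin m × Fin n) ℂ, F ≠ 0 ∧ ∀ U : Matrix (Fin m) (Fin n) ℂ,
      evalAt F U ≠ 0 → ∀ Z, dataMap Z = U.submatrix e₁ e₂ →
        eval (fun p => Z p.1 p.2) h ≠ 0 := by
  obtain ⟨F, hF, hFh⟩ := exists_generic_ne_zero (Fintype.card_congr (e₁.prodCongr e₂)).le
    (chartMap e₁ e₂) hh
  refine ⟨F, hF, fun U hU Z hZ => hFh _ ?_⟩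
  convert hU using 2
  simp only [evalAt, eval_chartMap]
  congr 2
  funext k
  have := congrFun (congrFun hZ (e₁.symm k.1)) (e₂.symm k.2)
  simp only [submatrix_apply, Equiv.apply_symm_apply] at this
  exact this

/-- A matrix all of whose minors of size `r` are non-zero. -/
theorem exists_rank_le_minors_ne_zero (m n r : ℕ) : ∃ P : Matrix (Fin m) (Fin n) ℂ, P.rank ≤ r ∧
    ∀ (σ : Fin r → Fin m) (τ : Fin r → Fin n), Function.Injective σ → Function.Injective τ →
      (P.submatrix σ τ).det ≠ 0 := by
  -- Each `r × r` minor of this product is a product of two Vandermonde determinants with distinct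
  -- nodes.
  refine ⟨(of fun i k => (i.1 : ℂ) ^ k.1 : Matrix (Fin m) (Fin r) ℂ) *
    (of fun j k => (j.1 : ℂ) ^ k.1 : Matrix (Fin n) (Fin r) ℂ)ᵀ, ?_, ?_⟩
  · exact (rank_mul_le_left _ _).trans ((rank_le_card_width _).trans (Fintype.card_fin r).le)
  · intro σ τ hσ hτ
    have : ((of fun i k => (i.1 : ℂ) ^ k.1 : Matrix (Fin m) (Fin r) ℂ) *
        (of fun j k => (j.1 : ℂ) ^ k.1 : Matrix (Fin n) (Fin r) ℂ)ᵀ).submatrix σ τ =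
        vandermonde (fun k => ((σ k).1 : ℂ)) * (vandermonde fun k => ((τ k).1 : ℂ))ᵀ := rfl
    rw [this, det_mul, det_transpose]
    refine mul_ne_zero (det_vandermonde_ne_zero_iff.2 ?_) (det_vandermonde_ne_zero_iff.2 ?_)
    · exact fun i j hij => hσ (Fin.ext (Nat.cast_injective (R := ℂ) hij))
    · exact fun i j hij => hτ (Fin.ext (Nat.cast_injective (R := ℂ) hij))

/-- In general position, the critical points in one chart lie in any other chart. -/
theorem exists_generic_mem_chart (e₁ e₁' : Fin r ⊕ Fin a ≃ Fin m)
    (e₂ e₂' : Fin r ⊕ Fin b ≃ Fin n) :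
    ∃ F : MvPolynomial (Fin m × Fin n) ℂ, F ≠ 0 ∧ ∀ U : Matrix (Fin m) (Fin n) ℂ,
      evalAt F U ≠ 0 → total U ≠ 0 → ∀ P ∈ critFiber (rankVariety m n r) U,
        IsUnit (P.submatrix e₁ e₂).toBlocks₁₁ → IsUnit (P.submatrix e₁' e₂').toBlocks₁₁ := by
  let L : ∀ {S : Type} [CommRing S], Matrix (Fin r ⊕ Fin a) (Fin r ⊕ Fin b) S →
      Matrix (Fin r) (Fin r) S := fun Z =>
    ((lowRank Z.toBlocks₁₁ Z.toBlocks₂₁ Z.toBlocks₁₂).submatrix (e₁.symm ∘ e₁')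
      (e₂.symm ∘ e₂')).toBlocks₁₁
  let h : MvPolynomial ((Fin r ⊕ Fin a) × (Fin r ⊕ Fin b)) ℂ := (L (mvPolynomialX _ _ ℂ)).det
  have heval : ∀ Z : Matrix (Fin r ⊕ Fin a) (Fin r ⊕ Fin b) ℂ,
      eval (fun p => Z p.1 p.2) h = (L Z).det := by
    intro Z
    rw [RingHom.map_det]
    congr 1
    let ev := eval fun p : (Fin r ⊕ Fin a) × (Fin r ⊕ Fin b) => Z p.1 p.2
    let T := mvPolynomialX (Fin r ⊕ Fin a) (Fin r ⊕ Fin b) ℂ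
    have hX : T.map ev = Z := map_eval_mvPolynomialX _
    have h11 : T.toBlocks₁₁.map ev = Z.toBlocks₁₁ := congrArg toBlocks₁₁ hX
    have h12 : T.toBlocks₁₂.map ev = Z.toBlocks₁₂ := congrArg toBlocks₁₂ hX
    have h21 : T.toBlocks₂₁.map ev = Z.toBlocks₂₁ := congrArg toBlocks₂₁ hX
    have h3 := lowRank_map ev T.toBlocks₁₁ T.toBlocks₂₁ T.toBlocks₁₂
    rw [h11, h12, h21] at h3
    ext i j
    exact congrFun (congrFun h3 ((e₁.symm ∘ e₁') (Sum.inl i))) ((e₂.symm ∘ e₂') (Sum.inl j))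
  have hh : h ≠ 0 := by
    -- The polynomial for the second chart is non-zero since a matrix with all minors non-zero lies
    -- in both charts.
    obtain ⟨P, hr, hP⟩ := exists_rank_le_minors_ne_zero m n r
    have hM : IsUnit (P.submatrix e₁ e₂).toBlocks₁₁ := by
      rw [isUnit_iff_isUnit_det, isUnit_iff_ne_zero]
      exact hP (e₁ ∘ Sum.inl) (e₂ ∘ Sum.inl) (e₁.injective.comp Sum.inl_injective)
        (e₂.injective.comp Sum.inl_injective)
    have hL := eq_lowRank hM (by rwa [rank_submatrix, Fintype.card_fin])
    intro h0
    have h1 := heval (fromBlocks (P.submatrix e₁ e₂).toBlocks₁₁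
      ((P.submatrix e₁ e₂).toBlocks₁₁⁻¹ * (P.submatrix e₁ e₂).toBlocks₁₂)
      ((P.submatrix e₁ e₂).toBlocks₂₁ * (P.submatrix e₁ e₂).toBlocks₁₁⁻¹) 0)
    have h2 : L (fromBlocks (P.submatrix e₁ e₂).toBlocks₁₁
      ((P.submatrix e₁ e₂).toBlocks₁₁⁻¹ * (P.submatrix e₁ e₂).toBlocks₁₂)
      ((P.submatrix e₁ e₂).toBlocks₂₁ * (P.submatrix e₁ e₂).toBlocks₁₁⁻¹) 0) =
        P.submatrix (e₁' ∘ Sum.inl) (e₂' ∘ Sum.inl) := by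
      simp only [L, toBlocks_fromBlocks₁₁, toBlocks_fromBlocks₁₂, toBlocks_fromBlocks₂₁, ← hL]
      ext i j
      simp [toBlocks₁₁]
    rw [h0, map_zero, h2] at h1
    exact hP (e₁' ∘ Sum.inl) (e₂' ∘ Sum.inl) (e₁'.injective.comp Sum.inl_injective)
      (e₂'.injective.comp Sum.inl_injective) h1.symm
  obtain ⟨F, hF, hFh⟩ := exists_generic_chart e₁ e₂ hh
  refine ⟨F, hF, fun U hU hu P hP hM => ?_⟩
  obtain ⟨Z, hZ, -, hZP⟩ := exists_chartPoint_eq e₁ e₂ hu hP hM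
  have := hFh U hU Z hZ
  rw [heval] at this
  rw [isUnit_iff_isUnit_det, isUnit_iff_ne_zero]
  have h2 : (P.submatrix e₁' e₂').toBlocks₁₁ = (total U)⁻¹ • L Z := by
    rw [← hZP]; rfl
  rw [h2, det_smul]
  exact mul_ne_zero (pow_ne_zero _ (inv_ne_zero hu)) this

/-- The outer factors only embed `N` as the lower right block, so the rank is that of `N`.
Non-vanishing of `det (N Nᵀ)` is a single polynomial condition that forces full row rank. -/
theorem rank_conormal {R A B : Type*} [Fintype R] [Fintype A] [Fintype B] [DecidableEq R]
    [DecidableEq A] [DecidableEq B] {N : Matrix A B ℂ} (hN : (N * Nᵀ).det ≠ 0) (X : Matrix A R ℂ)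
    (Y : Matrix R B ℂ) : (conormal N X Y).rank = Fintype.card A := by
  apply le_antisymm
  · rw [conormal, Matrix.mul_assoc]
    exact (rank_mul_le_left _ _).trans (rank_le_card_width _)
  · rw [← rank_of_det_ne_zero hN]
    refine (rank_mul_le_left _ _).trans ?_
    have : N = fromCols (0 : Matrix A R ℂ) (1 : Matrix A A ℂ) * conormal N X Y *
        fromRows (0 : Matrix R B ℂ) (1 : Matrix B B ℂ) := by
      rw [conormal, transpose_fromCols, transpose_fromRows, Matrix.mul_assoc, Matrix.mul_assoc,
        fromCols_mul_fromRows, Matrix.mul_assoc, ← Matrix.mul_assoc, fromCols_mul_fromRows]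
      simp
    conv_lhs => rw [this]
    exact (rank_mul_le_left _ _).trans (rank_mul_le_right _ _)

/-- In general position, the residual at a critical point in a chart has maximal rank. -/
theorem exists_generic_rank_residual_chart (hab : a ≤ b) (e₁ : Fin r ⊕ Fin a ≃ Fin m)
    (e₂ : Fin r ⊕ Fin b ≃ Fin n) :
    ∃ F : MvPolynomial (Fin m × Fin n) ℂ, F ≠ 0 ∧ ∀ U : Matrix (Fin m) (Fin n) ℂ,
      evalAt F U ≠ 0 → (∀ i j, U i j ≠ 0) → total U ≠ 0 →
        ∀ P ∈ critFiber (rankVariety m n r) U, IsUnit (P.submatrix e₁ e₂).toBlocks₁₁ →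
          (residual U P).rank = a := by
  let N₀ := (mvPolynomialX (Fin r ⊕ Fin a) (Fin r ⊕ Fin b) ℂ).toBlocks₂₂
  let h : MvPolynomial ((Fin r ⊕ Fin a) × (Fin r ⊕ Fin b)) ℂ := (N₀ * N₀ᵀ).det
  have heval : ∀ Z : Matrix (Fin r ⊕ Fin a) (Fin r ⊕ Fin b) ℂ,
      eval (fun p => Z p.1 p.2) h = (Z.toBlocks₂₂ * Z.toBlocks₂₂ᵀ).det := by
    intro Z
    rw [RingHom.map_det, RingHom.mapMatrix_apply, Matrix.map_mul, transpose_map]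
    have h22 : N₀.map (eval fun p => Z p.1 p.2) = Z.toBlocks₂₂ := congrArg toBlocks₂₂
      (map_eval_mvPolynomialX (fun p : (Fin r ⊕ Fin a) × (Fin r ⊕ Fin b) => Z p.1 p.2))
    rw [h22]
  have hh : h ≠ 0 := by
    intro h0
    -- The test value `N = (1 | 0)` satisfies `N Nᵀ = 1`.
    have h1 := heval (fromBlocks 0 0 0 ((1 : Matrix (Fin b) (Fin b) ℂ).submatrix
      (Fin.castLE hab) id))
    rw [h0, map_zero, toBlocks_fromBlocks₂₂, transpose_submatrix, transpose_one,
      ← submatrix_mul _ _ _ _ _ Function.bijective_id, Matrix.mul_one,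
      submatrix_one _ (Fin.castLE_injective hab), det_one] at h1
    exact zero_ne_one h1
  obtain ⟨F, hF, hFh⟩ := exists_generic_chart e₁ e₂ hh
  refine ⟨F, hF, fun U hFU hU hu P hP hM => ?_⟩
  obtain ⟨Z, hZ, hZM, hZP⟩ := exists_chartPoint_eq e₁ e₂ hu hP hM
  have h1 := hFh U hFU Z hZ
  rw [heval] at h1
  rw [← rank_submatrix _ e₁ e₂, ← hZP, (chartPoint_mem_critFiber e₁ e₂ hU hu hZ hZM).2,
    rank_smul_of_mem_nonZeroDivisors _ (mem_nonZeroDivisors_of_ne_zero hu), rank_conormal h1,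
    Fintype.card_fin]

theorem exists_generic_rank_residual (hmn : m ≤ n) (r : ℕ) :
    ∃ F : MvPolynomial (Fin m × Fin n) ℂ, F ≠ 0 ∧ ∀ U : Matrix (Fin m) (Fin n) ℂ,
      evalAt F U ≠ 0 → (∀ i j, U i j ≠ 0) → total U ≠ 0 →
        ∀ P ∈ critFiber (rankVariety m n r) U, (residual U P).rank = m - r := by
  choose F hF hFU using fun e : (Fin r ⊕ Fin (m - r) ≃ Fin m) × (Fin r ⊕ Fin (n - r) ≃ Fin n) =>
    exists_generic_rank_residual_chart (Nat.sub_le_sub_right hmn r) e.1 e.2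
  refine ⟨∏ e, F e, Finset.prod_ne_zero_iff.2 fun e _ => hF e, fun U hFe hU hu P hP => ?_⟩
  rw [evalAt, map_prod, Finset.prod_ne_zero_iff] at hFe
  obtain ⟨e₁, e₂, hM⟩ := exists_chart P hP.1.2.2
  exact hFU (e₁, e₂) U (hFe _ (Finset.mem_univ _)) hU hu P hP hM

/-- Each critical point lies in one of finitely many charts, and generically then also in the given
one. A count in one chart therefore misses nothing. -/
theorem exists_generic_forall_mem_chart (e₁ : Fin r ⊕ Fin (m - r) ≃ Fin m)
    (e₂ : Fin r ⊕ Fin (n - r) ≃ Fin n) :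
    ∃ F : MvPolynomial (Fin m × Fin n) ℂ, F ≠ 0 ∧ ∀ U : Matrix (Fin m) (Fin n) ℂ,
      evalAt F U ≠ 0 → total U ≠ 0 → ∀ P ∈ critFiber (rankVariety m n r) U,
        IsUnit (P.submatrix e₁ e₂).toBlocks₁₁ := by
  choose F hF hFU using fun e : (Fin r ⊕ Fin (m - r) ≃ Fin m) × (Fin r ⊕ Fin (n - r) ≃ Fin n) =>
    exists_generic_mem_chart e.1 e₁ e.2 e₂
  refine ⟨∏ e, F e, Finset.prod_ne_zero_iff.2 fun e _ => hF e, fun U hFe hu P hP => ?_⟩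
  rw [evalAt, map_prod, Finset.prod_ne_zero_iff] at hFe
  obtain ⟨e₁', e₂', hM⟩ := exists_chart P hP.1.2.2
  exact hFU (e₁', e₂') U (hFe _ (Finset.mem_univ _)) hu P hP hM

/-- The polynomial condition that entries, margins and the total of the data do not vanish. -/
theorem exists_generic_margins (hm : 0 < m) (hn : 0 < n) :
    ∃ F : MvPolynomial (Fin m × Fin n) ℂ, F ≠ 0 ∧ ∀ U : Matrix (Fin m) (Fin n) ℂ,
      evalAt F U ≠ 0 → (∀ i j, U i j ≠ 0) ∧ (∀ i, ∑ j, U i j ≠ 0) ∧ (∀ j, ∑ i, U i j ≠ 0) ∧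
        total U ≠ 0 := by
  let F : MvPolynomial (Fin m × Fin n) ℂ := (∏ i, ∏ j, X (i, j)) * (∏ i, ∑ j, X (i, j)) *
    (∏ j, ∑ i, X (i, j)) * ∑ i, ∑ j, X (i, j)
  have hF : ∀ U : Matrix (Fin m) (Fin n) ℂ, evalAt F U = (∏ i, ∏ j, U i j) *
      (∏ i, ∑ j, U i j) * (∏ j, ∑ i, U i j) * total U := by
    intro U; simp [F, evalAt, total]
  refine ⟨F, ?_, fun U hU => ?_⟩
  · intro h0
    have := hF (of fun _ _ => 1)
    rw [h0] at this
    simp [evalAt, total, hm.ne', hn.ne'] at this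
  · rw [hF] at hU
    simpa [mul_ne_zero_iff, Finset.prod_ne_zero_iff, and_assoc] using hU

/-- The varieties of matrices of fixed rank have an ML-degree. -/
theorem exists_hasMLDegree (hr : 1 ≤ r) (hrm : r ≤ m) (hmn : m ≤ n) :
    ∃ d, HasMLDegree (rankVariety m n r) d := by
  have : Nonempty (Fin r) := ⟨⟨0, hr⟩⟩
  obtain ⟨e₁, -⟩ := exists_equiv_sum_of_injective _ (Fin.castLE_injective hrm)
  obtain ⟨e₂, -⟩ := exists_equiv_sum_of_injective _ (Fin.castLE_injective (hrm.trans hmn))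
  obtain ⟨d, hd, F, hF, hFd⟩ := exists_generic_encard_fiber
    (Fintype.card_congr (e₁.prodCongr e₂)).le (algebraicIndependent_chartMap e₁ e₂)
  obtain ⟨F₁, hF₁, h₁⟩ := exists_generic_margins (hr.trans hrm) (hr.trans (hrm.trans hmn))
  obtain ⟨F₂, hF₂, h₂⟩ := exists_generic_forall_mem_chart e₁ e₂
  let M₀ := (mvPolynomialX (Fin r ⊕ Fin (m - r)) (Fin r ⊕ Fin (n - r)) ℂ).toBlocks₁₁
  have hM₀ : ∀ Z : Matrix (Fin r ⊕ Fin (m - r)) (Fin r ⊕ Fin (n - r)) ℂ,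
      eval (fun p => Z p.1 p.2) M₀.det = Z.toBlocks₁₁.det := by
    intro Z
    rw [RingHom.map_det]
    exact congrArg (fun Z => (toBlocks₁₁ Z).det) (map_eval_mvPolynomialX
      (fun p : (Fin r ⊕ Fin (m - r)) × (Fin r ⊕ Fin (n - r)) => Z p.1 p.2))
  -- Parameters with singular `M` do not describe matrices of rank `r`; general data exclude them
  -- from the fibre.
  obtain ⟨F₃, hF₃, h₃⟩ := exists_generic_chart e₁ e₂ (h := M₀.det) (by
    intro h0
    have := hM₀ (fromBlocks 1 0 0 0)
    rw [h0, map_zero, toBlocks_fromBlocks₁₁, det_one] at this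
    exact zero_ne_one this)
  refine ⟨d, hd, F * F₁ * F₂ * F₃, mul_ne_zero (mul_ne_zero (mul_ne_zero hF hF₁) hF₂) hF₃,
    fun U hFU => ?_⟩
  simp only [evalAt_mul, mul_ne_zero_iff] at hFU
  obtain ⟨⟨⟨hU, hU₁⟩, hU₂⟩, hU₃⟩ := hFU
  obtain ⟨hU0, -, -, hu⟩ := h₁ U hU₁
  rw [← hFd (fun k => U k.1 k.2) hU]
  let toMat : ((Fin r ⊕ Fin (m - r)) × (Fin r ⊕ Fin (n - r)) → ℂ) →
    Matrix (Fin r ⊕ Fin (m - r)) (Fin r ⊕ Fin (n - r)) ℂ := fun x => of fun i j => x (i, j)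
  have hfib : ∀ x, (∀ k, eval x (chartMap e₁ e₂ k) = U k.1 k.2) ↔
      dataMap (toMat x) = U.submatrix e₁ e₂ := by
    intro x
    simp only [eval_chartMap]
    refine ⟨fun h => ?_, fun h k => ?_⟩
    · ext i j
      simpa using h (e₁ i, e₂ j)
    · simpa using congrFun (congrFun h (e₁.symm k.1)) (e₂.symm k.2)
  have hunit : ∀ Z, dataMap Z = U.submatrix e₁ e₂ → IsUnit Z.toBlocks₁₁ := by
    intro Z hZ
    rw [isUnit_iff_isUnit_det, isUnit_iff_ne_zero, ← hM₀]
    exact h₃ U hU₃ Z hZ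
  have himage : critFiber (rankVariety m n r) U = (fun x => chartPoint e₁ e₂ (total U) (toMat x)) ''
      {x | ∀ k, eval x (chartMap e₁ e₂ k) = U k.1 k.2} := by
    ext P
    refine ⟨fun hP => ?_, ?_⟩
    · obtain ⟨Z, hZ, -, hZP⟩ := exists_chartPoint_eq e₁ e₂ hu hP (h₂ U hU₂ hu P hP)
      exact ⟨fun p => Z p.1 p.2, (hfib _).2 hZ, hZP⟩
    · rintro ⟨x, hx, rfl⟩
      have hZ := (hfib x).1 hx
      exact (chartPoint_mem_critFiber e₁ e₂ hU0 hu hZ (hunit _ hZ)).1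
  rw [himage, Set.InjOn.encard_image]
  intro x hx y hy hxy
  have hZ := (hfib x).1 hx
  have hZ' := (hfib y).1 hy
  have := chartPoint_injective e₁ e₂ hU0 hu hZ hZ' (hunit _ hZ) (hunit _ hZ') hxy
  funext p
  exact congrFun (congrFun this p.1) p.2

end Generic

/-! ### The duality map on critical points. -/

section Duality

open Matrix

variable {m n r : ℕ}

/-- The entrywise quotient of the data by a critical point has rank one more than the residual. -/
theorem rank_quotient {U P : Matrix (Fin m) (Fin n) ℂ} (hu : total U ≠ 0) (hP : total P = 1)
    (h1 : residual U P * Pᵀ = 0) (h2 : Pᵀ * residual U P = 0) :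
    (of fun i j => U i j / P i j : Matrix (Fin m) (Fin n) ℂ).rank = (residual U P).rank + 1 := by
  set W := residual U P with hW
  set T : Matrix (Fin m) (Fin n) ℂ := of fun i j => U i j / P i j with hT
  -- `T` is `W` plus `u_{++}` times the all-ones matrix.
  have hTW : ∀ x, T *ᵥ x = W *ᵥ x + (total U * ∑ j, x j) • (1 : Fin m → ℂ) := by
    intro x
    funext i
    simp only [mulVec, dotProduct, hT, hW, residual_apply, of_apply, Pi.add_apply, Pi.smul_apply,
      Pi.one_apply, smul_eq_mul, mul_one, sub_mul, Finset.sum_sub_distrib, Finset.mul_sum]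
    ring
  have hw : W *ᵥ (Pᵀ *ᵥ 1) = 0 := by rw [mulVec_mulVec, h1, zero_mulVec]
  have hsum : ∑ j, (Pᵀ *ᵥ (1 : Fin m → ℂ)) j = 1 := by
    simp only [mulVec, dotProduct, transpose_apply, Pi.one_apply, mul_one]
    rw [Finset.sum_comm]
    exact hP
  -- This places the all-ones vector in the range of `T`; `hdisj` shows that it is not in the range
  -- of `W`, whose vectors are killed by `Pᵀ`.
  have hone : T *ᵥ (Pᵀ *ᵥ 1) = total U • (1 : Fin m → ℂ) := by
    rw [hTW, hw, hsum, mul_one, zero_add]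
  have hrange : LinearMap.range T.mulVecLin =
      LinearMap.range W.mulVecLin ⊔ Submodule.span ℂ {(1 : Fin m → ℂ)} := by
    have hmem : (1 : Fin m → ℂ) ∈ LinearMap.range T.mulVecLin := by
      refine ⟨(total U)⁻¹ • (Pᵀ *ᵥ 1), ?_⟩
      rw [map_smul, mulVecLin_apply, hone, inv_smul_smul₀ hu]
    apply le_antisymm
    · rintro _ ⟨x, rfl⟩
      rw [mulVecLin_apply, hTW]
      exact Submodule.add_mem_sup ⟨x, rfl⟩
        (Submodule.smul_mem _ _ (Submodule.mem_span_singleton_self _))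
    · refine sup_le ?_ ((Submodule.span_singleton_le_iff_mem _ _).2 hmem)
      rintro _ ⟨x, rfl⟩
      rw [mulVecLin_apply, eq_sub_of_add_eq (hTW x).symm]
      exact Submodule.sub_mem _ ⟨x, rfl⟩ (Submodule.smul_mem _ _ hmem)
  have hdisj : LinearMap.range W.mulVecLin ⊓ Submodule.span ℂ {(1 : Fin m → ℂ)} = ⊥ := by
    rw [eq_bot_iff]
    rintro _ ⟨⟨x, rfl⟩, hx⟩
    obtain ⟨c, hc⟩ := Submodule.mem_span_singleton.1 hx
    have h3 : Pᵀ *ᵥ (c • (1 : Fin m → ℂ)) = 0 := by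
      rw [hc, mulVecLin_apply, mulVec_mulVec, h2, zero_mulVec]
    rw [mulVec_smul] at h3
    have h4 : c * ∑ j, (Pᵀ *ᵥ (1 : Fin m → ℂ)) j = 0 := by
      rw [Finset.mul_sum]
      exact Finset.sum_eq_zero fun j _ => congrFun h3 j
    rw [hsum, mul_one] at h4
    rw [← hc, h4, zero_smul]
    exact Submodule.zero_mem _
  have hm : (1 : Fin m → ℂ) ≠ 0 := by
    intro h0
    rw [h0, mulVec_zero] at hsum
    simp at hsum
  have := Submodule.finrank_sup_add_finrank_inf_eq (LinearMap.range W.mulVecLin)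
    (Submodule.span ℂ {(1 : Fin m → ℂ)})
  rw [hdisj, finrank_bot, add_zero, ← hrange, finrank_span_singleton hm] at this
  exact this

theorem dual_apply (U P : Matrix (Fin m) (Fin n) ℂ) (i : Fin m) (j : Fin n) :
    dual U P i j = ((∑ j', U i j') * U i j * (∑ i', U i' j) / P i j) / total U ^ 3 := rfl

theorem dual_dual {U P : Matrix (Fin m) (Fin n) ℂ} (hU : ∀ i j, U i j ≠ 0)
    (hrow : ∀ i, ∑ j, U i j ≠ 0) (hcol : ∀ j, ∑ i, U i j ≠ 0) (hu : total U ≠ 0)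
    (hP : ∀ i j, P i j ≠ 0) : dual U (dual U P) = P := by
  ext i j
  have h1 := hU i j
  have h2 := hrow i
  have h3 := hcol j
  have h4 := hP i j
  rw [dual_apply, dual_apply]
  field_simp

/-- The dual of a critical point whose residual has rank `s` is a critical point on the matrices
of rank `s + 1`. -/
theorem dual_mem_critFiber {s : ℕ} {U P : Matrix (Fin m) (Fin n) ℂ} (hU : ∀ i j, U i j ≠ 0)
    (hrow : ∀ i, ∑ j, U i j ≠ 0) (hcol : ∀ j, ∑ i, U i j ≠ 0) (hu : total U ≠ 0)
    (hP : P ∈ critFiber (rankVariety m n r) U) (hs : (residual U P).rank = s) :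
    dual U P ∈ critFiber (rankVariety m n (s + 1)) U := by
  obtain ⟨⟨hP0, hP1, -⟩, h1, h2⟩ := mem_critFiber_rankVariety_iff.1 hP
  -- the critical equations
  have hA : ∀ k i, ∑ j, U k j / P k j * P i j = total U * ∑ j, P i j := by
    intro k i
    have := congrFun (congrFun h1 k) i
    simp only [Matrix.mul_apply, transpose_apply, residual_apply, sub_mul,
      Finset.sum_sub_distrib, ← Finset.mul_sum, Matrix.zero_apply] at this
    exact sub_eq_zero.1 this
  have hB : ∀ k j, ∑ i, U i k / P i k * P i j = total U * ∑ i, P i j := by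
    intro k j
    have := congrFun (congrFun h2 j) k
    simp only [Matrix.mul_apply, transpose_apply, residual_apply, mul_sub,
      Finset.sum_sub_distrib, ← Finset.sum_mul, Matrix.zero_apply] at this
    rw [mul_comm (total U), ← sub_eq_zero.1 this]
    exact Finset.sum_congr rfl fun i _ => mul_comm _ _
  -- The diagonal critical equations say that `U` has the margins of `P` scaled by `u_{++}`.
  have hrowP : ∀ i, ∑ j, U i j = total U * ∑ j, P i j := by
    intro i
    rw [← hA i i]
    exact Finset.sum_congr rfl fun j _ => (div_mul_cancel₀ _ (hP0 i j)).symm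
  have hcolP : ∀ j, ∑ i, U i j = total U * ∑ i, P i j := by
    intro j
    rw [← hB j j]
    exact Finset.sum_congr rfl fun i _ => (div_mul_cancel₀ _ (hP0 i j)).symm
  -- the margins of the dual matrix
  have hrowD : ∀ i, ∑ j, dual U P i j = (∑ j, U i j) / total U := by
    intro i
    -- Replace the column margins of `U` by those of `P`, then sum the critical equations over the
    -- second row index.
    have h3 : ∑ j, U i j / P i j * ∑ k, U k j = total U ^ 2 := by
      simp only [hcolP, Finset.mul_sum]
      rw [Finset.sum_comm]
      calc ∑ k, ∑ j, U i j / P i j * (total U * P k j)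
          = ∑ k, total U * ∑ j, U i j / P i j * P k j := by
            simp only [Finset.mul_sum]
            exact Finset.sum_congr rfl fun k _ => Finset.sum_congr rfl fun j _ => by ring
        _ = total U ^ 2 := by
            simp only [hA, ← Finset.mul_sum]
            rw [hP1]; ring
    have h4 : ∀ j, dual U P i j =
        (∑ j', U i j') / total U ^ 3 * (U i j / P i j * ∑ k, U k j) := fun j => by
      rw [dual_apply]; ring
    simp only [h4, ← Finset.mul_sum, h3]
    field_simp
  have hcolD : ∀ j, ∑ i, dual U P i j = (∑ i, U i j) / total U := by
    intro j
    have h3 : ∑ i, U i j / P i j * ∑ k, U i k = total U ^ 2 := by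
      simp only [hrowP, Finset.mul_sum]
      rw [Finset.sum_comm]
      calc ∑ k, ∑ i, U i j / P i j * (total U * P i k)
          = ∑ k, total U * ∑ i, U i j / P i j * P i k := by
            simp only [Finset.mul_sum]
            exact Finset.sum_congr rfl fun k _ => Finset.sum_congr rfl fun j _ => by ring
        _ = total U ^ 2 := by
            simp only [hB, ← Finset.mul_sum]
            rw [Finset.sum_comm, hP1]; ring
    have h4 : ∀ i, dual U P i j =
        (∑ i', U i' j) / total U ^ 3 * (U i j / P i j * ∑ k, U i k) := fun i => by
      rw [dual_apply]; ring
    simp only [h4, ← Finset.mul_sum, h3]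
    field_simp
  have hD0 : ∀ i j, dual U P i j ≠ 0 := fun i j => by
    rw [dual_apply]
    exact div_ne_zero (div_ne_zero (mul_ne_zero (mul_ne_zero (hrow i) (hU i j)) (hcol j)) (hP0 i j))
      (pow_ne_zero 3 hu)
  have hres : ∀ i j, residual U (dual U P) i j =
      total U ^ 3 * P i j / ((∑ j', U i j') * ∑ i', U i' j) - total U := by
    intro i j
    have h3 := hU i j
    have h4 := hrow i
    have h5 := hcol j
    have h6 := hP0 i j
    rw [residual_apply, dual_apply]
    field_simp
  refine mem_critFiber_rankVariety_iff.2 ⟨⟨hD0, ?_, ?_⟩, ?_, ?_⟩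
  · simp only [hrowD, ← Finset.sum_div]
    exact div_self hu
  -- Row and column scaling by non-zero margins leaves the rank of `U / P` unchanged.
  · have hfac : dual U P = (total U ^ 3)⁻¹ • (diagonal (fun i => ∑ j, U i j) *
        (of fun i j => U i j / P i j) * diagonal (fun j => ∑ i, U i j)) := by
      ext i j
      simp only [dual_apply, Matrix.smul_apply, mul_diagonal, diagonal_mul, of_apply, smul_eq_mul]
      ring
    have hd1 : (diagonal fun i => ∑ j, U i j).det ≠ 0 := by
      rw [det_diagonal]; exact Finset.prod_ne_zero_iff.2 fun i _ => hrow i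
    have hd2 : (diagonal fun j => ∑ i, U i j).det ≠ 0 := by
      rw [det_diagonal]; exact Finset.prod_ne_zero_iff.2 fun j _ => hcol j
    rw [hfac, rank_smul_of_mem_nonZeroDivisors _
      (mem_nonZeroDivisors_of_ne_zero (inv_ne_zero (pow_ne_zero 3 hu))),
      rank_mul_eq_left_of_det_ne_zero _ _ hd2, rank_mul_eq_right_of_det_ne_zero _ _ hd1,
      rank_quotient hu hP1 h1 h2, hs]
  · ext k i
    simp only [Matrix.mul_apply, transpose_apply, hres, sub_mul, Finset.sum_sub_distrib,
      ← Finset.mul_sum, hrowD, Matrix.zero_apply]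
    -- In the product of entries the column margins and `u_{++}^3` cancel, leaving a critical
    -- equation of `P` with its two row indices interchanged.
    have h3 : ∀ j, total U ^ 3 * P k j / ((∑ j', U k j') * ∑ i', U i' j) * dual U P i j =
        (∑ j', U i j') / (∑ j', U k j') * (U i j / P i j * P k j) := fun j => by
      have h4 := hcol j
      have h5 := hrow k
      rw [dual_apply]
      field_simp
    simp only [h3, ← Finset.mul_sum, hA, ← hrowP]
    have := hrow k
    field_simp
    ring
  · ext k i
    simp only [Matrix.mul_apply, transpose_apply, hres, mul_sub, Finset.sum_sub_distrib,
      ← Finset.sum_mul, hcolD, Matrix.zero_apply]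
    have h3 : ∀ j, dual U P j k * (total U ^ 3 * P j i / ((∑ j', U j j') * ∑ i', U i' i)) =
        (∑ i', U i' k) / (∑ i', U i' i) * (U j k / P j k * P j i) := fun j => by
      have h4 := hcol i
      have h5 := hrow j
      rw [dual_apply]
      field_simp
    simp only [h3, ← Finset.mul_sum, hB, ← hcolP]
    have := hcol i
    field_simp
    ring

/-- The product of the likelihoods of a matrix and its dual. -/
theorem likelihood_mul_likelihood_dual (U : Matrix (Fin m) (Fin n) ℕ)
    {P : Matrix (Fin m) (Fin n) ℂ} (hP : ∀ i j, P i j ≠ 0) :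
    likelihood U P * likelihood U (dual (U.map (fun u => (u : ℂ))) P) =
      likelihood U (dual (U.map (fun u => (u : ℂ))) (of fun _ _ => 1)) := by
  simp only [likelihood, ← Finset.prod_mul_distrib, ← mul_pow]
  refine Finset.prod_congr rfl fun i _ => Finset.prod_congr rfl fun j _ => ?_
  congr 1
  have := hP i j
  simp only [dual_apply, of_apply]
  field_simp

/-- ML-duality at general data. -/
theorem exists_generic_duality (hr : 1 ≤ r) (hrm : r ≤ m) (hmn : m ≤ n) :
    ∃ F : MvPolynomial (Fin m × Fin n) ℂ, F ≠ 0 ∧ ∀ U : Matrix (Fin m) (Fin n) ℂ, evalAt F U ≠ 0 →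
      Set.BijOn (dual U) (critFiber (rankVariety m n r) U)
        (critFiber (rankVariety m n (m - r + 1)) U) ∧
      Set.InvOn (dual U) (dual U) (critFiber (rankVariety m n r) U)
        (critFiber (rankVariety m n (m - r + 1)) U) := by
  obtain ⟨F₁, hF₁, h₁⟩ := exists_generic_margins (hr.trans hrm) (hr.trans (hrm.trans hmn))
  obtain ⟨F₂, hF₂, h₂⟩ := exists_generic_rank_residual hmn r
  obtain ⟨F₃, hF₃, h₃⟩ := exists_generic_rank_residual hmn (m - r + 1)
  refine ⟨F₁ * F₂ * F₃, mul_ne_zero (mul_ne_zero hF₁ hF₂) hF₃, fun U hU => ?_⟩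
  simp only [evalAt_mul, mul_ne_zero_iff] at hU
  obtain ⟨⟨hU₁, hU₂⟩, hU₃⟩ := hU
  obtain ⟨hU0, hrow, hcol, hu⟩ := h₁ U hU₁
  have hinv : Set.InvOn (dual U) (dual U) (critFiber (rankVariety m n r) U)
      (critFiber (rankVariety m n (m - r + 1)) U) :=
    ⟨fun P hP => dual_dual hU0 hrow hcol hu hP.1.1, fun P hP => dual_dual hU0 hrow hcol hu hP.1.1⟩
  refine ⟨hinv.bijOn (fun P hP => ?_) (fun P hP => ?_), hinv⟩
  · exact dual_mem_critFiber hU0 hrow hcol hu hP (h₂ U hU₂ hU0 hu P hP)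
  · have := dual_mem_critFiber hU0 hrow hcol hu hP (h₃ U hU₃ hU0 hu P hP)
    -- The truncated subtraction is exact because `1 ≤ r ≤ m`.
    rwa [show m - (m - r + 1) + 1 = r by omega] at this

end Duality

end MLDuality

/-! ### Assembly of the three statements. -/

theorem mainTheorem1 (m n : ℕ) (hmn : m ≤ n) :
    ∃ c : Matrix (Fin m) (Fin n) ℕ → ℂ,
      ∀ r : ℕ, 1 ≤ r → r ≤ m →
        (∃ F : MvPolynomial (Fin m × Fin n) ℂ, F ≠ 0 ∧
          (∀ U : Matrix (Fin m) (Fin n) ℂ, MLDuality.evalAt F U ≠ 0 →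
            Set.BijOn (MLDuality.dual U)
              (MLDuality.critFiber (MLDuality.rankVariety m n r) U)
              (MLDuality.critFiber (MLDuality.rankVariety m n (m - r + 1)) U) ∧
            Set.InvOn (MLDuality.dual U) (MLDuality.dual U)
              (MLDuality.critFiber (MLDuality.rankVariety m n r) U)
              (MLDuality.critFiber (MLDuality.rankVariety m n (m - r + 1)) U)) ∧
          (∀ U : Matrix (Fin m) (Fin n) ℕ,
            MLDuality.evalAt F (U.map (fun u => (u : ℂ))) ≠ 0 →
            Set.BijOn (MLDuality.dual (U.map (fun u => (u : ℂ))))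
              (MLDuality.criticalPoints (MLDuality.rankVariety m n r) U)
              (MLDuality.criticalPoints (MLDuality.rankVariety m n (m - r + 1)) U) ∧
            Set.InvOn (MLDuality.dual (U.map (fun u => (u : ℂ))))
              (MLDuality.dual (U.map (fun u => (u : ℂ))))
              (MLDuality.criticalPoints (MLDuality.rankVariety m n r) U)
              (MLDuality.criticalPoints (MLDuality.rankVariety m n (m - r + 1)) U) ∧
            ∀ P ∈ MLDuality.criticalPoints (MLDuality.rankVariety m n r) U,
              MLDuality.likelihood U P *
                MLDuality.likelihood U (MLDuality.dual (U.map (fun u => (u : ℂ))) P) = c U)) ∧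
        ∃ d : ℕ, MLDuality.HasMLDegree (MLDuality.rankVariety m n r) d ∧
          MLDuality.HasMLDegree (MLDuality.rankVariety m n (m - r + 1)) d := by
  -- The entries of `P` cancel in the product, so the constant is found by putting `P` equal to the
  -- all-ones matrix; `r` does not enter.
  refine ⟨fun U => MLDuality.likelihood U
    (MLDuality.dual (U.map (fun u => (u : ℂ))) (Matrix.of fun _ _ => 1)), fun r hr hrm => ⟨?_, ?_⟩⟩
  · obtain ⟨F, hF, hdual⟩ := MLDuality.exists_generic_duality hr hrm hmn
    have hcrit : ∀ (s : ℕ) (U : Matrix (Fin m) (Fin n) ℕ),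
        MLDuality.criticalPoints (MLDuality.rankVariety m n s) U =
          MLDuality.critFiber (MLDuality.rankVariety m n s) (U.map (fun u => (u : ℂ))) :=
      fun s => MLDuality.criticalPoints_eq_critFiber _ fun P hP => hP.1
    refine ⟨F, hF, hdual, fun U hU => ?_⟩
    rw [hcrit, hcrit]
    exact ⟨(hdual _ hU).1, (hdual _ hU).2, fun P hP =>
      MLDuality.likelihood_mul_likelihood_dual U hP.1.1⟩
  · obtain ⟨F, hF, hdual⟩ := MLDuality.exists_generic_duality hr hrm hmn
    obtain ⟨d, hd, G, hG, hcard⟩ := MLDuality.exists_hasMLDegree hr hrm hmn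
    -- The degree for rank `m - r + 1` is transported along the duality bijection, valid off the
    -- hypersurface of `F * G`.
    refine ⟨d, ⟨hd, G, hG, hcard⟩, hd, F * G, mul_ne_zero hF hG, fun U hU => ?_⟩
    rw [MLDuality.evalAt_mul, mul_ne_zero_iff] at hU
    have h := (hdual U hU.1).1
    rw [← h.image_eq, h.injOn.encard_image, hcard U hU.2]
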